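/- Let $n\ge 1$, let $s>1$ be a noninteger real number and let $B_1=\{x\in\mathbb R^n:|x|<1\}$. A function $u:\mathbb R^n\to\mathbb R$ is called a weak solution of \[(-\Delta)^s u=1\ \text{ in } B_1,\qquad u=0\ \text{ in }\mathbb R^n\setminus B_1 \] if $u\in H^s(\mathbb R^n)$, $u=0$ a.e. in $\mathbb R^n\setminus B_1$, and $\langle(-\Delta)^s u,\varphi\rangle=\int_{B_1}\varphi\,dx$ for all real $\varphi\in C_c^\infty(B_1)$. Here $(-\Delta)^s u$ is defined by $\widehat{(-\Delta)^su}(\xi)=|\xi|^{2s}\,\widehat u(\xi)$ with $\widehat u(\xi)=\int e^{-ix\cdot\xi}u(x)\,dx$, so that $\langle(-\Delta)^s u,\varphi\rangle=(2\pi)^{-n}\int_{\mathbb R^n}|\xi|^{2s}\,\widehat u(\xi)\,\overline{\widehat\varphi(\xi)}\,d\xi$. Then the problem has exactly one weak solution up to equality almost everywhere, and it is given by \[u(x)=\frac{2^{-2s}\,\Gamma(n/2)}{\Gamma\left(\frac{n+2s}{2}\right)\Gamma(1+s)}\,(1-|x|^2)^s\ \text{ in } B_1,\qquad u=0\ \text{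 in }\mathbb R^n\setminus B_1 .\] That is, a function $u:\mathbb R^n\to\mathbb R$ is a weak solution if and only if these two equalities hold for almost every $x\in\mathbb R^n$. -/

import Mathlib

open MeasureTheory Metric
open scoped FourierTransform SchwartzMap ContDiff ENNReal ComplexConjugate

noncomputable section

/-- The action of the distribution `(-Δ)^s u`, for `u` in `H^s(ℝⁿ)`, on a real test function `φ`.
By definition the Fourier transform of `(-Δ)^s u` is `|ξ|^(2s) û(ξ)`, so by Parseval this is
`∫ |ξ|^(2s) û(ξ) conj(φ̂(ξ)) dξ`. Mathlib's Fourier transform has the kernel `exp (-2πi⟨x, ξ⟩)`,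
and in this normalization the symbol `|ξ|^(2s)` is `(2π‖ξ‖)^(2s)` (for `s = 1` it is the symbol
of `-Δ`). Here `𝓕 u` is the Fourier transform on `L²` and `𝓕 φ` the Fourier integral. -/
def fracLaplacianPairing {n : ℕ} (s : ℝ) (u : Lp ℂ 2 (volume : Measure (EuclideanSpace ℝ (Fin n))))
    (φ : EuclideanSpace ℝ (Fin n) → ℝ) : ℂ :=
  ∫ ξ : EuclideanSpace ℝ (Fin n),
    (((2 * Real.pi * ‖ξ‖) ^ (2 * s) : ℝ) : ℂ) * (𝓕 u) ξ * conj (𝓕 (fun x => (φ x : ℂ)) ξ)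

/-- The real function `u` is an `H^s(ℝⁿ)` weak solution of the Dirichlet problem
`(-Δ)^s u = g` in `Ω`, `u = 0` in `ℝⁿ \ Ω`: it belongs to `H^s(ℝⁿ)`, vanishes almost everywhere
outside `Ω`, and `⟨(-Δ)^s u, φ⟩ = ∫_Ω g φ` for every test function `φ ∈ C_c^∞(Ω)`.
(`Ω` is open and `g` is locally integrable on `Ω`.) -/
structure IsWeakDirichletSolution {n : ℕ} (s : ℝ) (Ω : Set (EuclideanSpace ℝ (Fin n)))
    (g u : EuclideanSpace ℝ (Fin n) → ℝ) : Prop where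
  /-- `u` is square integrable. -/
  memLp : MemLp (fun x => (u x : ℂ)) 2 volume
  /-- `u` lies in `H^s(ℝⁿ)`. -/
  memSobolev : TemperedDistribution.MemSobolev s 2
    (memLp.toLp : 𝓢'(EuclideanSpace ℝ (Fin n), ℂ))
  /-- `u` vanishes outside `Ω`. -/
  eq_zero : ∀ᵐ x ∂volume, x ∉ Ω → u x = 0
  /-- `(-Δ)^s u = g` in `Ω` in the sense of distributions. -/
  equation : ∀ φ : EuclideanSpace ℝ (Fin n) → ℝ,
    ContDiff ℝ ∞ φ → HasCompactSupport φ → tsupport φ ⊆ Ω →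
      fracLaplacianPairing s memLp.toLp φ = ((∫ x in Ω, g x * φ x : ℝ) : ℂ)

end

open Filter Topology

/-! Existence comes from computing `(-Δ)^s` of the profile `(1 - ‖x‖ ^ 2)_+ ^ s` through an Abel
regularization: the symbol `(2π‖ξ‖) ^ (2s)` is multiplied by `exp (-2πε‖ξ‖)` and `ε` tends to `0`
from the right. In polar coordinates the transform of the profile along a ray is the one-dimensional
transform of its marginal, and that marginal is again such a profile, with exponent `σ = s + m / 2`
where `n = m + 1`. The radial integral is then a Gamma integral, so the regularized kernel is a
spherical mean of the holomorphic function `F(ζ) = ∫ (1 - t ^ 2)_+ ^ σ (ζ + i t) ^ (-(2σ + 1)) dt`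
at `ζ = ε - i ⟨x, w⟩` (`dampedKernel_eq`).

For this exponent `F'` is a real multiple of `(1 + ζ ^ 2) ^ (-(σ + 1))` (`bubblePower_eq_mul_cpow`),
which is real on the segment `(-i, i)`. Hence `Re F` has a constant limit there
(`tendsto_re_bubblePower`). Since the kernel is real, it tends to a constant throughout the ball
(`tendsto_dampedKernel`), and Gamma identities evaluate that constant (`torsionConst_eq`). The
growth of `F` near `±i` is compensated by the vanishing of the profile at the sphere, which gives
finite energy (`integrable_rpow_mul_fourier_bubble_sq`).

For uniqueness, let `w` be the difference of two solutions. Mollifications of the dilations `w(l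
x)`, `l > 1`, are test functions in the ball, so the energy pairing of `w` with each of its
dilations vanishes. Letting `l` tend to `1` shows that `w` has zero energy
(`ae_eq_zero_of_orthogonal`). -/

/-- The profile `(1 - ‖x‖ ^ 2)_+ ^ s`. -/
noncomputable def bubble {E : Type*} [Norm E] (s : ℝ) (x : E) : ℝ := (max 0 (1 - ‖x‖ ^ 2)) ^ s

/-! ### Elementary properties of the profile. -/

section Bubble

variable {E : Type*} [NormedAddCommGroup E] {s : ℝ}

lemma bubble_nonneg (s : ℝ) (x : E) : 0 ≤ bubble s x :=
  Real.rpow_nonneg (le_max_left _ _) _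

lemma bubble_of_one_le (hs : 0 < s) {x : E} (hx : 1 ≤ ‖x‖) : bubble s x = 0 := by
  have : max 0 (1 - ‖x‖ ^ 2) = 0 := max_eq_left (by nlinarith)
  rw [bubble, this, Real.zero_rpow hs.ne']

lemma bubble_of_norm_le_one (s : ℝ) {x : E} (hx : ‖x‖ ≤ 1) :
    bubble s x = (1 - ‖x‖ ^ 2) ^ s := by
  rw [bubble, max_eq_right (by nlinarith [norm_nonneg x])]

lemma continuous_bubble (hs : 0 < s) : Continuous (bubble s : E → ℝ) := by
  unfold bubble
  exact (by fun_prop : Continuous fun x : E => max 0 (1 - ‖x‖ ^ 2)).rpow_const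
    fun _ => Or.inr hs.le

lemma support_bubble_subset (hs : 0 < s) :
    Function.support (bubble s : E → ℝ) ⊆ ball 0 1 := by
  intro x hx
  by_contra h
  exact hx (bubble_of_one_le hs (by simpa using h))

lemma hasCompactSupport_bubble [ProperSpace E] (hs : 0 < s) :
    HasCompactSupport (bubble s : E → ℝ) :=
  HasCompactSupport.of_support_subset_isCompact (isCompact_closedBall 0 1)
    ((support_bubble_subset hs).trans ball_subset_closedBall)

lemma integrable_bubble [ProperSpace E] [MeasurableSpace E] [BorelSpace E] {μ : Measure E}
    [IsFiniteMeasureOnCompacts μ] (hs : 0 < s) : Integrable (bubble s : E → ℝ) μ :=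
  (continuous_bubble hs).integrable_of_hasCompactSupport (hasCompactSupport_bubble hs)

end Bubble

/-! ### The one-dimensional holomorphic integrals and their closed form. -/

/-- The integral `∫ (1 - t ^ 2)_+ ^ σ (ζ + i t) ^ a dt`. -/
noncomputable def bubblePower (σ a : ℝ) (ζ : ℂ) : ℂ :=
  ∫ t : ℝ, (bubble σ t : ℂ) * (ζ + t * Complex.I) ^ (a : ℂ)

section BubblePower

variable {σ a : ℝ} {ζ : ℂ}

lemma re_add_mul_I (ζ : ℂ) (t : ℝ) : (ζ + t * Complex.I).re = ζ.re := by simp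

lemma add_mul_I_mem_slitPlane (hζ : 0 < ζ.re) (t : ℝ) :
    ζ + t * Complex.I ∈ Complex.slitPlane := Or.inl (by simpa using hζ)

lemma norm_cpow_le_of_re {a r : ℝ} (ha : a ≤ 0) (hr : 0 < r) {z : ℂ} (hz : r ≤ z.re) :
    ‖z ^ (a : ℂ)‖ ≤ r ^ a := by
  rw [Complex.norm_cpow_real]
  exact Real.rpow_le_rpow_of_nonpos hr (hz.trans (Complex.re_le_norm z)) ha

lemma continuous_add_mul_I_cpow (hζ : 0 < ζ.re) (a : ℂ) :
    Continuous fun t : ℝ => (ζ + t * Complex.I) ^ a :=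
  Continuous.cpow (by fun_prop) continuous_const fun t => add_mul_I_mem_slitPlane hζ t

lemma integrable_bubble_mul (hσ : 0 < σ) {f : ℝ → ℂ} (hf : Continuous f) :
    Integrable fun t : ℝ => (bubble σ t : ℂ) * f t := by
  refine Continuous.integrable_of_hasCompactSupport
    ((Complex.continuous_ofReal.comp (continuous_bubble hσ)).mul hf) ?_
  have : HasCompactSupport fun t : ℝ => (bubble σ t : ℂ) :=
    (hasCompactSupport_bubble (E := ℝ) hσ).comp_left (g := fun x : ℝ => (x : ℂ)) rfl
  exact this.mul_right

lemma hasDerivAt_bubblePower (hσ : 0 < σ) (ha : a ≤ 0) (hζ : 0 < ζ.re) :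
    HasDerivAt (bubblePower σ a) (a * bubblePower σ (a - 1) ζ) ζ := by
  -- On the half-plane `Re z > Re ζ / 2` the base `z + i t` has modulus at least `Re ζ / 2`; as `a -
  -- 1 ≤ 0`, the derivative is dominated by a constant times the profile.
  have hr : 0 < ζ.re / 2 := by positivity
  have hopen : IsOpen {z : ℂ | ζ.re / 2 < z.re} := isOpen_lt continuous_const Complex.continuous_re
  have hmem : {z : ℂ | ζ.re / 2 < z.re} ∈ 𝓝 ζ := hopen.mem_nhds (by
    simp only [Set.mem_ofPred_eq]; linarith)
  have key := hasDerivAt_integral_of_dominated_loc_of_deriv_le (𝕜 := ℂ) (μ := volume)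
    (F := fun z (t : ℝ) => (bubble σ t : ℂ) * (z + t * Complex.I) ^ (a : ℂ))
    (F' := fun z (t : ℝ) => (bubble σ t : ℂ) *
      ((a : ℂ) * (z + t * Complex.I) ^ ((a : ℂ) - 1)))
    (bound := fun t => bubble σ t * (|a| * (ζ.re / 2) ^ (a - 1))) hmem
    ?_ ?_ ?_ ?_ ?_ ?_
  · have h := key.2
    have e : ∫ t : ℝ, (bubble σ t : ℂ) * ((a : ℂ) * (ζ + t * Complex.I) ^ ((a : ℂ) - 1)) =
        a * bubblePower σ (a - 1) ζ := by
      rw [bubblePower, ← integral_const_mul]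
      congr 1
      ext t
      push_cast
      ring
    rw [e] at h
    exact h
  · filter_upwards [hmem] with z hz
    exact (integrable_bubble_mul hσ
      (continuous_add_mul_I_cpow (hr.trans hz) _)).aestronglyMeasurable
  · exact integrable_bubble_mul hσ (continuous_add_mul_I_cpow hζ _)
  · exact (integrable_bubble_mul hσ
      (continuous_const.mul (continuous_add_mul_I_cpow hζ _))).aestronglyMeasurable
  · refine Eventually.of_forall fun t z hz => ?_
    rw [norm_mul, norm_mul, Complex.norm_real, Complex.norm_real, Real.norm_eq_abs,
      Real.norm_eq_abs, abs_of_nonneg (bubble_nonneg σ t)]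
    refine mul_le_mul_of_nonneg_left (mul_le_mul_of_nonneg_left ?_ (abs_nonneg a))
      (bubble_nonneg σ t)
    have := norm_cpow_le_of_re (a := a - 1) (by linarith) hr (z := z + t * Complex.I)
      (by rw [re_add_mul_I]; exact le_of_lt hz)
    simpa using this
  · exact (integrable_bubble hσ).mul_const _
  · refine Eventually.of_forall fun t z hz => ?_
    have h1 : HasDerivAt (fun z : ℂ => z + t * Complex.I) 1 z := (hasDerivAt_id z).add_const _
    have h2 := h1.cpow_const (c := (a : ℂ)) (add_mul_I_mem_slitPlane (hr.trans hz) t)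
    simpa using h2.const_mul (bubble σ t : ℂ)

lemma bubblePower_eq_intervalIntegral (hσ : 0 < σ) (a : ℝ) (ζ : ℂ) :
    bubblePower σ a ζ =
      ∫ t in (-1 : ℝ)..1, (bubble σ t : ℂ) * (ζ + t * Complex.I) ^ (a : ℂ) := by
  rw [intervalIntegral.integral_eq_integral_of_support_subset, bubblePower]
  intro t ht
  have : t ∈ ball (0 : ℝ) 1 := support_bubble_subset hσ (by
    intro h
    apply ht
    simp [h])
  rw [Real.ball_eq_Ioo] at this
  exact ⟨by linarith [this.1], by linarith [this.2]⟩

/-- Integration by parts identity behind the differential equation for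
`∫ (1 - t ^ 2)_+ ^ σ (ζ + i t) ^ (-2σ - 2) dt`. -/
lemma bubblePower_identity (hσ : 0 < σ) (hζ : 0 < ζ.re) :
    (1 + ζ ^ 2) * bubblePower σ (-(2 * σ + 3)) ζ = ζ * bubblePower σ (-(2 * σ + 2)) ζ := by
  have hint := fun b : ℝ => (integrable_bubble_mul hσ
    (continuous_add_mul_I_cpow hζ (b : ℂ)))
  -- `g` vanishes at `±1`. With the exponent `-(2σ + 2)` the quadratic terms in `t` cancel in its
  -- derivative, since `t (ζ + i t) + i (1 - t ^ 2) = i (1 - i ζ t)`.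
  set g : ℝ → ℂ := fun t => ((1 - t ^ 2 : ℝ) ^ (σ + 1) : ℝ) *
    (ζ + t * Complex.I) ^ ((-(2 * σ + 2) : ℝ) : ℂ) with hg
  set g' : ℝ → ℂ := fun t => (bubble σ t : ℂ) * (-(2 * (σ + 1) * Complex.I) *
    (1 - ζ * (t * Complex.I)) * (ζ + t * Complex.I) ^ ((-(2 * σ + 3) : ℝ) : ℂ)) with hg'
  have hcont : ContinuousOn g (Set.Icc (-1) 1) := by
    refine ContinuousOn.mul (Complex.continuous_ofReal.comp_continuousOn ?_)
      (continuous_add_mul_I_cpow hζ _).continuousOn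
    exact ((by fun_prop : Continuous fun t : ℝ => 1 - t ^ 2).rpow_const
      fun _ => Or.inr (by linarith)).continuousOn
  have hderiv : ∀ t ∈ Set.Ioo (-1 : ℝ) 1, HasDerivAt g (g' t) t := by
    intro t ht
    have hpos : 0 < 1 - t ^ 2 := by nlinarith [ht.1, ht.2]
    have h1 : HasDerivAt (fun t : ℝ => (1 - t ^ 2) ^ (σ + 1))
        (-(2 * t) * (σ + 1) * (1 - t ^ 2) ^ σ) t := by
      have : HasDerivAt (fun t : ℝ => 1 - t ^ 2) (-(2 * t)) t := by
        simpa using (hasDerivAt_pow 2 t).const_sub 1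
      simpa using this.rpow_const (p := σ + 1) (Or.inl hpos.ne')
    have h2 : HasDerivAt (fun z : ℂ => ζ + z * Complex.I) Complex.I (t : ℂ) := by
      simpa using ((hasDerivAt_id (t : ℂ)).mul_const Complex.I).const_add ζ
    have h3 := (h2.cpow_const (c := ((-(2 * σ + 2) : ℝ) : ℂ))
      (add_mul_I_mem_slitPlane hζ t)).comp_ofReal
    have hne : ζ + t * Complex.I ≠ 0 := Complex.slitPlane_ne_zero (add_mul_I_mem_slitPlane hζ t)
    have e1 : ((-(2 * σ + 2) : ℝ) : ℂ) - 1 = ((-(2 * σ + 3) : ℝ) : ℂ) := by push_cast; ring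
    have e2 : (ζ + t * Complex.I) ^ ((-(2 * σ + 2) : ℝ) : ℂ) =
        (ζ + t * Complex.I) ^ ((-(2 * σ + 3) : ℝ) : ℂ) * (ζ + t * Complex.I) := by
      have : ((-(2 * σ + 2) : ℝ) : ℂ) = ((-(2 * σ + 3) : ℝ) : ℂ) + 1 := by push_cast; ring
      rw [this, Complex.cpow_add _ _ hne, Complex.cpow_one]
    have e3 : bubble σ t = (1 - t ^ 2) ^ σ := by
      rw [bubble_of_norm_le_one σ (abs_le.2 ⟨ht.1.le, ht.2.le⟩)]
      simp
    have e4 : (1 - t ^ 2) ^ (σ + 1) = (1 - t ^ 2) ^ σ * (1 - t ^ 2) := by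
      rw [Real.rpow_add_one hpos.ne']
    convert! h1.ofReal_comp.mul h3 using 1
    simp only [hg', e1, e2, e3, e4]
    push_cast
    linear_combination (2 * (σ + 1) * ζ * t * (((1 - t ^ 2) ^ σ : ℝ) : ℂ) *
      (ζ + t * Complex.I) ^ (-(2 * (σ : ℂ) + 3))) * Complex.I_sq
  have hg'int : IntervalIntegrable g' volume (-1) 1 := by
    refine Integrable.intervalIntegrable (integrable_bubble_mul hσ ?_)
    exact (by fun_prop : Continuous fun t : ℝ => -(2 * (σ + 1) * Complex.I) *
      (1 - ζ * (t * Complex.I))).mul (continuous_add_mul_I_cpow hζ _)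
  have hzero : ∫ t in (-1 : ℝ)..1, g' t = 0 := by
    rw [intervalIntegral.integral_eq_sub_of_hasDerivAt_of_le (by norm_num) hcont hderiv hg'int]
    simp [hg, Real.zero_rpow (by linarith : σ + 1 ≠ 0)]
  -- The affine factor of `g'` is the required combination: `1 + ζ ^ 2 - ζ (ζ + i t) = 1 - i ζ t`.
  have hpt : ∀ t : ℝ, (1 + ζ ^ 2) * ((bubble σ t : ℂ) *
      (ζ + t * Complex.I) ^ ((-(2 * σ + 3) : ℝ) : ℂ)) -
      ζ * ((bubble σ t : ℂ) * (ζ + t * Complex.I) ^ ((-(2 * σ + 2) : ℝ) : ℂ)) =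
      (-(2 * (σ + 1) * Complex.I))⁻¹ * g' t := by
    intro t
    have hne : ζ + t * Complex.I ≠ 0 := Complex.slitPlane_ne_zero (add_mul_I_mem_slitPlane hζ t)
    have e2 : (ζ + t * Complex.I) ^ ((-(2 * σ + 2) : ℝ) : ℂ) =
        (ζ + t * Complex.I) ^ ((-(2 * σ + 3) : ℝ) : ℂ) * (ζ + t * Complex.I) := by
      have : ((-(2 * σ + 2) : ℝ) : ℂ) = ((-(2 * σ + 3) : ℝ) : ℂ) + 1 := by push_cast; ring
      rw [this, Complex.cpow_add _ _ hne, Complex.cpow_one]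
    have hc : (σ : ℂ) + 1 ≠ 0 := by
      have : ((σ + 1 : ℝ) : ℂ) ≠ 0 := by exact_mod_cast (by linarith : σ + 1 ≠ 0)
      simpa using this
    have hc' : -(2 * ((σ : ℂ) + 1) * Complex.I) ≠ 0 := by simp [hc]
    rw [e2, hg', eq_inv_mul_iff_mul_eq₀ hc']
    ring
  rw [bubblePower_eq_intervalIntegral hσ, bubblePower_eq_intervalIntegral hσ, ← sub_eq_zero,
    ← intervalIntegral.integral_const_mul, ← intervalIntegral.integral_const_mul,
    ← intervalIntegral.integral_sub ((hint _).const_mul _).intervalIntegrable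
      ((hint _).const_mul _).intervalIntegrable]
  simp_rw [hpt]
  rw [intervalIntegral.integral_const_mul, hzero, mul_zero]

/-- `1 + ζ ^ 2` meets the cut only for imaginary `ζ`, so the principal powers of it are holomorphic
on the open right half-plane. -/
lemma one_add_sq_mem_slitPlane (hζ : 0 < ζ.re) : 1 + ζ ^ 2 ∈ Complex.slitPlane := by
  rw [Complex.mem_slitPlane_iff]
  by_cases h : ζ.im = 0
  · left
    simp [pow_two, h]
    positivity
  · right
    simp only [pow_two, Complex.add_im, Complex.one_im, Complex.mul_im]
    have := mul_ne_zero hζ.ne' h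
    intro h'
    apply this
    linarith

/-- Factoring out `r ^ a` leaves `(1 + i t / r) ^ a`, which tends to `1` and has modulus at most `1`
because `a ≤ 0`. This behaviour at infinity fixes the constants of integration below. -/
lemma tendsto_bubblePower_mul_rpow (hσ : 0 < σ) (ha : a ≤ 0) :
    Tendsto (fun r : ℝ => ((r ^ (-a) : ℝ) : ℂ) * bubblePower σ a r) atTop
      (𝓝 (∫ t : ℝ, bubble σ t : ℝ)) := by
  have hre : ∀ x : ℝ, (1 + x * Complex.I).re = 1 := fun x => by simp
  have e : (fun r : ℝ => ((r ^ (-a) : ℝ) : ℂ) * bubblePower σ a r) =ᶠ[atTop]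
      fun r : ℝ => ∫ t : ℝ, (bubble σ t : ℂ) * (1 + (t / r : ℝ) * Complex.I) ^ (a : ℂ) := by
    filter_upwards [eventually_gt_atTop 0] with r hr
    rw [bubblePower, ← integral_const_mul]
    congr 1
    ext t
    have hr' : (r : ℂ) ≠ 0 := by exact_mod_cast hr.ne'
    have h1 : (r : ℂ) + t * Complex.I = r * (1 + (t / r : ℝ) * Complex.I) := by
      push_cast
      field_simp
    have h2 : ((r : ℂ) * (1 + (t / r : ℝ) * Complex.I)) ^ (a : ℂ) =
        (r : ℂ) ^ (a : ℂ) * (1 + (t / r : ℝ) * Complex.I) ^ (a : ℂ) := by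
      have h0 : 1 + ((t / r : ℝ) : ℂ) * Complex.I ≠ 0 := by
        intro h
        have := congrArg Complex.re h
        rw [hre] at this
        simp at this
      rw [Complex.cpow_def_of_ne_zero (mul_ne_zero hr' h0), Complex.cpow_def_of_ne_zero hr',
        Complex.cpow_def_of_ne_zero h0, Complex.log_ofReal_mul hr h0, ← Complex.exp_add,
        Complex.ofReal_log hr.le]
      ring_nf
    have h3 : ((r ^ (-a) : ℝ) : ℂ) * (r : ℂ) ^ (a : ℂ) = 1 := by
      rw [← Complex.ofReal_cpow hr.le, ← Complex.ofReal_mul, ← Real.rpow_add hr]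
      simp
    rw [h1, h2]
    linear_combination (bubble σ t : ℂ) * (1 + (t / r : ℝ) * Complex.I) ^ (a : ℂ) * h3
  rw [tendsto_congr' e, ← integral_complex_ofReal]
  refine tendsto_integral_filter_of_dominated_convergence (fun t => bubble σ t) ?_ ?_
    (integrable_bubble hσ) ?_
  · refine Eventually.of_forall fun r => (integrable_bubble_mul hσ ?_).aestronglyMeasurable
    refine Continuous.cpow (by fun_prop) continuous_const fun t => Or.inl ?_
    rw [hre]
    exact one_pos
  · refine Eventually.of_forall fun r => Eventually.of_forall fun t => ?_
    rw [norm_mul, Complex.norm_real, Real.norm_eq_abs, abs_of_nonneg (bubble_nonneg σ t)]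
    have := norm_cpow_le_of_re ha one_pos (z := 1 + (t / r : ℝ) * Complex.I) (hre _).ge
    rw [Real.one_rpow] at this
    exact mul_le_of_le_one_right (bubble_nonneg σ t) this
  · refine Eventually.of_forall fun t => ?_
    have h1 : Tendsto (fun r : ℝ => 1 + ((t / r : ℝ) : ℂ) * Complex.I) atTop (𝓝 1) := by
      have : Tendsto (fun r : ℝ => t / r) atTop (𝓝 0) := tendsto_id.const_div_atTop t
      simpa using (((Complex.continuous_ofReal.tendsto 0).comp this).mul_const
        Complex.I).const_add 1
    have h2 := (continuousAt_cpow_const (b := (a : ℂ)) Complex.one_mem_slitPlane).tendsto.comp h1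
    simpa using h2.const_mul (bubble σ t : ℂ)

/-- The closed form of `∫ (1 - t ^ 2)_+ ^ σ (ζ + i t) ^ (-2σ - 2) dt`. -/
lemma bubblePower_eq_mul_cpow (hσ : 0 < σ) (hζ : 0 < ζ.re) :
    bubblePower σ (-(2 * σ + 2)) ζ =
      (∫ t : ℝ, bubble σ t : ℝ) * (1 + ζ ^ 2) ^ ((-(σ + 1) : ℝ) : ℂ) := by
  -- By `bubblePower_identity` the integral solves `F' = -(2σ + 2) ζ / (1 + ζ ^ 2) F`, so
  -- multiplying by the integrating factor gives a constant on the half-plane, read off at `+∞`.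
  set H : ℂ → ℂ := fun z => bubblePower σ (-(2 * σ + 2)) z * (1 + z ^ 2) ^ ((σ + 1 : ℝ) : ℂ)
  have hopen : IsOpen {z : ℂ | 0 < z.re} := isOpen_lt continuous_const Complex.continuous_re
  have hconv : Convex ℝ {z : ℂ | 0 < z.re} := convex_halfSpace_re_gt 0
  have hd : ∀ z : ℂ, 0 < z.re → HasDerivAt H 0 z := by
    intro z hz
    have h1 := hasDerivAt_bubblePower hσ (a := -(2 * σ + 2)) (by linarith) hz
    have h2 : HasDerivAt (fun z : ℂ => 1 + z ^ 2) (2 * z) z := by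
      simpa using (hasDerivAt_pow 2 z).const_add 1
    have h3 := h2.cpow_const (c := ((σ + 1 : ℝ) : ℂ)) (one_add_sq_mem_slitPlane hz)
    convert! h1.mul h3 using 1
    have hne : 1 + z ^ 2 ≠ 0 := Complex.slitPlane_ne_zero (one_add_sq_mem_slitPlane hz)
    have e1 : (1 + z ^ 2) ^ ((σ + 1 : ℝ) : ℂ) =
        (1 + z ^ 2) ^ (((σ + 1 : ℝ) : ℂ) - 1) * (1 + z ^ 2) := by
      conv_rhs => rw [← Complex.cpow_one (1 + z ^ 2), Complex.cpow_one (1 + z ^ 2)]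
      rw [Complex.cpow_sub _ _ hne, Complex.cpow_one]
      field_simp
    have e2 : -(2 * σ + 2) - 1 = -(2 * σ + 3) := by ring
    have hid := bubblePower_identity hσ hz
    rw [e1, e2]
    push_cast at *
    linear_combination (2 * (σ + 1)) * (1 + z ^ 2) ^ ((σ : ℂ) + 1 - 1) * hid
  have hconst : ∀ z w : ℂ, 0 < z.re → 0 < w.re → H z = H w := by
    intro z w hz hw
    exact hopen.is_const_of_deriv_eq_zero hconv.isPreconnected
      (fun x hx => (hd x hx).differentiableAt.differentiableWithinAt)
      (fun x hx => (hd x hx).deriv) hz hw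
  have hlim : Tendsto (fun r : ℝ => H r) atTop (𝓝 (∫ t : ℝ, bubble σ t : ℝ)) := by
    have h1 := tendsto_bubblePower_mul_rpow hσ (a := -(2 * σ + 2)) (by linarith)
    have h2 : Tendsto (fun r : ℝ => (((1 + r⁻¹ ^ 2) ^ (σ + 1) : ℝ) : ℂ)) atTop (𝓝 1) := by
      have h3 : Tendsto (fun r : ℝ => 1 + r⁻¹ ^ 2) atTop (𝓝 1) := by
        simpa using (tendsto_inv_atTop_zero.pow 2).const_add (1 : ℝ)
      have h4 := h3.rpow_const (p := σ + 1) (Or.inl one_ne_zero)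
      rw [Real.one_rpow] at h4
      exact (Complex.continuous_ofReal.tendsto 1).comp h4
    have h5 := h2.mul h1
    rw [one_mul] at h5
    refine h5.congr' ?_
    filter_upwards [eventually_gt_atTop 0] with r hr
    have hr2 : (1 + r ^ 2) = (1 + r⁻¹ ^ 2) * r ^ 2 := by field_simp; ring
    have e : (1 + (r : ℂ) ^ 2) ^ ((σ + 1 : ℝ) : ℂ) =
        (((1 + r⁻¹ ^ 2) ^ (σ + 1) : ℝ) : ℂ) * ((r ^ (-(-(2 * σ + 2))) : ℝ) : ℂ) := by
      rw [← Complex.ofReal_mul]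
      have : (1 + (r : ℂ) ^ 2) = ((1 + r ^ 2 : ℝ) : ℂ) := by push_cast; ring
      rw [this, ← Complex.ofReal_cpow (by positivity), hr2,
        Real.mul_rpow (by positivity) (by positivity), ← Real.rpow_natCast r 2,
        ← Real.rpow_mul hr.le]
      congr 3
      push_cast
      ring
    simp only [H, e]
    ring
  have hval : H ζ = (∫ t : ℝ, bubble σ t : ℝ) := by
    refine tendsto_nhds_unique ?_ hlim
    refine tendsto_const_nhds.congr' ?_
    filter_upwards [eventually_gt_atTop 0] with r hr
    exact hconst _ _ hζ (by simpa using hr)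
  rw [← hval]
  have hne : 1 + ζ ^ 2 ≠ 0 := Complex.slitPlane_ne_zero (one_add_sq_mem_slitPlane hζ)
  simp only [H]
  rw [mul_assoc, ← Complex.cpow_add _ _ hne]
  simp

end BubblePower

/-! ### Two real integrals in terms of Gamma values. -/

section Constants

lemma integrable_one_add_sq_rpow {p : ℝ} (hp : 1 / 2 < p) :
    Integrable fun r : ℝ => (1 + r ^ 2) ^ (-p) := by
  have := integrable_rpow_neg_one_add_norm_sq (E := ℝ) (μ := volume) (r := 2 * p)
    (by simp; linarith)
  refine this.congr (Eventually.of_forall fun r => ?_)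
  simp only [Real.norm_eq_abs, sq_abs]
  congr 1
  ring

/-- Write `Γ(p) (1 + r ^ 2) ^ (-p)` as `∫ t ^ (p - 1) exp (-(1 + r ^ 2) t) dt` and exchange the
integrals: the `r`-integral is Gaussian and leaves a Gamma integral with parameter `p - 1 / 2`. -/
lemma integral_Ioi_one_add_sq_rpow {p : ℝ} (hp : 1 / 2 < p) :
    ∫ r in Set.Ioi (0 : ℝ), (1 + r ^ 2) ^ (-p) =
      Real.sqrt Real.pi / 2 * Real.Gamma (p - 1 / 2) / Real.Gamma p := by
  have hp0 : 0 < p := by linarith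
  have hG : 0 < Real.Gamma p := Real.Gamma_pos_of_pos hp0
  set f : ℝ → ℝ → ℝ := fun r t => t ^ (p - 1) * Real.exp (-((1 + r ^ 2) * t)) with hf
  have hfr : ∀ r : ℝ, ∫ t in Set.Ioi (0 : ℝ), f r t = Real.Gamma p * (1 + r ^ 2) ^ (-p) := by
    intro r
    rw [hf, Real.integral_rpow_mul_exp_neg_mul_Ioi hp0 (by positivity : 0 < 1 + r ^ 2), one_div,
      Real.inv_rpow (by positivity), Real.rpow_neg (by positivity), mul_comm]
  have hint : Integrable (Function.uncurry f)
      ((volume.restrict (Set.Ioi (0 : ℝ))).prod (volume.restrict (Set.Ioi (0 : ℝ)))) := by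
    rw [integrable_prod_iff]
    · refine ⟨Eventually.of_forall fun r => ?_, ?_⟩
      -- The Bochner integral of a nonintegrable function is `0`, so the positive value in `hfr`
      -- already proves integrability.
      · refine Integrable.of_integral_ne_zero ?_
        change ∫ t in Set.Ioi (0 : ℝ), f r t ≠ 0
        rw [hfr]
        positivity
      · have : ∀ r, ∫ t in Set.Ioi (0 : ℝ), ‖Function.uncurry f (r, t)‖ =
            Real.Gamma p * (1 + r ^ 2) ^ (-p) := by
          intro r
          rw [← hfr]
          refine setIntegral_congr_fun measurableSet_Ioi fun t ht => ?_
          have : 0 < t := ht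
          simp only [Function.uncurry, Real.norm_eq_abs, hf]
          exact abs_of_nonneg (by positivity)
        simp_rw [this]
        exact ((integrable_one_add_sq_rpow hp).const_mul _).integrableOn
    · refine Measurable.aestronglyMeasurable ?_
      simp only [hf, Function.uncurry_def]
      fun_prop
  have hswap := integral_integral_swap hint
  simp_rw [hfr] at hswap
  rw [integral_const_mul] at hswap
  have hinner : ∀ t ∈ Set.Ioi (0 : ℝ), ∫ r in Set.Ioi (0 : ℝ), f r t =
      Real.sqrt Real.pi / 2 * (t ^ ((p - 1 / 2) - 1) * Real.exp (-(1 * t))) := by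
    intro t ht
    have ht' : 0 < t := ht
    have e : ∀ r : ℝ, f r t = t ^ (p - 1) * Real.exp (-t) * Real.exp (-t * r ^ 2) := by
      intro r
      rw [mul_assoc, ← Real.exp_add]
      simp only [hf]
      congr 2
      ring
    simp_rw [e]
    rw [integral_const_mul, integral_gaussian_Ioi, Real.sqrt_div' _ ht'.le,
      Real.sqrt_eq_rpow t]
    have : t ^ (p - 1 / 2 - 1) = t ^ (p - 1) / t ^ (1 / 2 : ℝ) := by
      rw [← Real.rpow_sub ht']
      congr 1
      ring
    rw [this, one_mul]
    ring
  rw [setIntegral_congr_fun measurableSet_Ioi hinner, integral_const_mul,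
    Real.integral_rpow_mul_exp_neg_mul_Ioi (by linarith) one_pos] at hswap
  rw [eq_div_iff hG.ne', mul_comm, hswap]
  simp

/-- The substitution `y = t ^ 2` turns the integral into the Beta integral with parameters `1 / 2`
and `σ + 1`. -/
lemma integral_bubble_real {σ : ℝ} (hσ : 0 < σ) :
    ∫ t : ℝ, bubble σ t =
      Real.sqrt Real.pi * Real.Gamma (σ + 1) / Real.Gamma (σ + 3 / 2) := by
  have h1 : ∫ t : ℝ, bubble σ t = 2 * ∫ t in Set.Ioi (0 : ℝ), bubble σ t := by
    rw [← integral_comp_abs]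
    congr 1
    ext t
    simp [bubble]
  set g : ℝ → ℝ := fun y => y ^ (-(1 / 2) : ℝ) * (max 0 (1 - y)) ^ σ with hg
  have h2 : 2 * ∫ t in Set.Ioi (0 : ℝ), bubble σ t = ∫ y in Set.Ioi (0 : ℝ), g y := by
    rw [← integral_comp_rpow_Ioi_of_pos (g := g) two_pos, ← integral_const_mul]
    refine setIntegral_congr_fun measurableSet_Ioi fun t ht => ?_
    have ht' : 0 < t := ht
    have e1 : (t ^ (2 : ℝ)) ^ (-(1 / 2) : ℝ) = t⁻¹ := by
      rw [← Real.rpow_mul ht'.le, ← Real.rpow_neg_one]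
      norm_num
    simp only [hg, e1, bubble, smul_eq_mul, Real.norm_eq_abs, sq_abs]
    norm_num
    field_simp
  have h3 : ∫ y in Set.Ioi (0 : ℝ), g y = ∫ y in (0 : ℝ)..1,
      y ^ ((1 / 2 : ℝ) - 1) * (1 - y) ^ ((σ + 1) - 1) := by
    rw [intervalIntegral.integral_of_le zero_le_one]
    rw [setIntegral_eq_of_subset_of_forall_sdiff_eq_zero (s := Set.Ioc (0 : ℝ) 1)
      (t := Set.Ioi 0) measurableSet_Ioi Set.Ioc_subset_Ioi_self (f := g)]
    · refine setIntegral_congr_fun measurableSet_Ioc fun y hy => ?_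
      simp only [hg]
      rw [max_eq_right (by linarith [hy.2])]
      norm_num
    · rintro y ⟨hy, hy'⟩
      have : 1 < y := by
        by_contra h
        exact hy' ⟨hy, not_lt.1 h⟩
      simp only [hg]
      rw [max_eq_left (by linarith), Real.zero_rpow hσ.ne', mul_zero]
  have h4 := ProbabilityTheory.beta_eq_betaIntegralReal (1 / 2) (σ + 1) (by norm_num)
    (by linarith)
  have h5 : Complex.betaIntegral ((1 / 2 : ℝ) : ℂ) ((σ + 1 : ℝ) : ℂ) = ((∫ y in (0 : ℝ)..1,
      y ^ ((1 / 2 : ℝ) - 1) * (1 - y) ^ ((σ + 1) - 1) : ℝ) : ℂ) := by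
    rw [← intervalIntegral.integral_ofReal, Complex.betaIntegral]
    refine intervalIntegral.integral_congr fun y hy => ?_
    rw [Set.uIcc_of_le zero_le_one] at hy
    rw [Complex.ofReal_mul, Complex.ofReal_cpow hy.1, Complex.ofReal_cpow (by linarith [hy.2])]
    push_cast
    ring
  rw [h1, h2, h3, ← Complex.ofReal_re (∫ y in (0 : ℝ)..1,
      y ^ ((1 / 2 : ℝ) - 1) * (1 - y) ^ ((σ + 1) - 1)), ← h5, ← h4, ProbabilityTheory.beta,
      Real.Gamma_one_half_eq]
  congr 2
  ring

end Constants

/-! ### The Gamma integral with complex parameter. -/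

section Laplace

lemma integrableOn_rpow_mul_exp_neg {b c : ℝ} (hb : -1 < b) (hc : 0 < c) :
    IntegrableOn (fun t : ℝ => t ^ b * Real.exp (-(c * t))) (Set.Ioi 0) := by
  have := integrableOn_rpow_mul_exp_neg_mul_rpow hb one_pos hc
  simpa using this

lemma norm_rpow_mul_cexp {t : ℝ} (ht : 0 < t) (b : ℝ) (z : ℂ) :
    ‖((t ^ b : ℝ) : ℂ) * Complex.exp (-(z * t))‖ = t ^ b * Real.exp (-(z.re * t)) := by
  rw [norm_mul, Complex.norm_real, Complex.norm_exp, Real.norm_eq_abs,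
    abs_of_nonneg (by positivity)]
  simp

lemma integrableOn_rpow_mul_cexp_neg {b : ℝ} (hb : -1 < b) {z : ℂ} (hz : 0 < z.re) :
    IntegrableOn (fun t : ℝ => ((t ^ b : ℝ) : ℂ) * Complex.exp (-(z * t))) (Set.Ioi 0) := by
  refine (integrableOn_rpow_mul_exp_neg hb hz).mono' ?_ ?_
  · refine Measurable.aestronglyMeasurable ?_
    fun_prop
  · filter_upwards [ae_restrict_mem measurableSet_Ioi] with t ht
    rw [norm_rpow_mul_cexp ht]

/-- Both sides are holomorphic on the right half-plane and agree on the positive reals, which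
accumulate at `1`; the identity theorem does the rest. -/
lemma integral_rpow_mul_cexp_neg {p : ℝ} (hp : 0 < p) {z : ℂ} (hz : 0 < z.re) :
    ∫ t in Set.Ioi (0 : ℝ), ((t ^ (p - 1) : ℝ) : ℂ) * Complex.exp (-(z * t)) =
      Real.Gamma p * z ^ ((-p : ℝ) : ℂ) := by
  set S : ℂ → ℂ := fun z => ∫ t in Set.Ioi (0 : ℝ),
    ((t ^ (p - 1) : ℝ) : ℂ) * Complex.exp (-(z * t)) with hS
  have hopen : IsOpen {z : ℂ | 0 < z.re} := isOpen_lt continuous_const Complex.continuous_re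
  have hconv : Convex ℝ {z : ℂ | 0 < z.re} := convex_halfSpace_re_gt 0
  have hd : ∀ z : ℂ, 0 < z.re → DifferentiableAt ℂ S z := by
    intro z hz
    have hr : 0 < z.re / 2 := by positivity
    have hmem : {w : ℂ | z.re / 2 < w.re} ∈ 𝓝 z :=
      (isOpen_lt continuous_const Complex.continuous_re).mem_nhds (by
        simp only [Set.mem_ofPred_eq]; linarith)
    have key := hasDerivAt_integral_of_dominated_loc_of_deriv_le (𝕜 := ℂ)
      (μ := volume.restrict (Set.Ioi (0 : ℝ)))
      (F := fun z (t : ℝ) => ((t ^ (p - 1) : ℝ) : ℂ) * Complex.exp (-(z * t)))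
      (F' := fun z (t : ℝ) => ((t ^ (p - 1) : ℝ) : ℂ) * (Complex.exp (-(z * t)) * (-t)))
      (bound := fun t => t ^ p * Real.exp (-(z.re / 2 * t))) hmem
      (Eventually.of_forall fun w => Measurable.aestronglyMeasurable (by fun_prop))
      (integrableOn_rpow_mul_cexp_neg (by linarith) hz)
      (Measurable.aestronglyMeasurable (by fun_prop)) ?_
      (integrableOn_rpow_mul_exp_neg (by linarith) hr) ?_
    · exact key.2.differentiableAt
    · filter_upwards [ae_restrict_mem measurableSet_Ioi] with t ht w hw
      have ht' : 0 < t := ht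
      have hw' : z.re / 2 < w.re := hw
      rw [← mul_assoc, norm_mul, norm_rpow_mul_cexp ht', norm_neg, Complex.norm_real,
        Real.norm_eq_abs, abs_of_pos ht']
      have : t ^ p = t ^ (p - 1) * t := by
        rw [← Real.rpow_add_one ht'.ne']
        congr 1
        ring
      rw [this]
      have : Real.exp (-(w.re * t)) ≤ Real.exp (-(z.re / 2 * t)) := by
        apply Real.exp_le_exp.2
        nlinarith
      have h0 : 0 ≤ t ^ (p - 1) := by positivity
      calc t ^ (p - 1) * Real.exp (-(w.re * t)) * t
          = t ^ (p - 1) * t * Real.exp (-(w.re * t)) := by ring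
        _ ≤ _ := by gcongr
    · refine Eventually.of_forall fun t w _ => ?_
      have : HasDerivAt (fun w : ℂ => -(w * t)) (-t : ℂ) w := by
        have h0 : HasDerivAt (fun w : ℂ => w * t) (t : ℂ) w := by
          simpa using (hasDerivAt_id w).mul_const (t : ℂ)
        exact h0.neg
      exact this.cexp.const_mul _
  have hA : AnalyticOnNhd ℂ S {z : ℂ | 0 < z.re} :=
    DifferentiableOn.analyticOnNhd (fun w hw => (hd w hw).differentiableWithinAt) hopen
  have hB : AnalyticOnNhd ℂ (fun z : ℂ => (Real.Gamma p : ℂ) * z ^ ((-p : ℝ) : ℂ))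
      {z : ℂ | 0 < z.re} := by
    refine DifferentiableOn.analyticOnNhd (fun w hw => ?_) hopen
    have : w ∈ Complex.slitPlane := Or.inl hw
    exact ((differentiableAt_id.cpow_const this).const_mul _).differentiableWithinAt
  have hreal : ∀ r : ℝ, 0 < r → S r = (Real.Gamma p : ℂ) * (r : ℂ) ^ ((-p : ℝ) : ℂ) := by
    intro r hr
    have h := Real.integral_rpow_mul_exp_neg_mul_Ioi hp hr
    have h' := congrArg (fun x : ℝ => (x : ℂ)) h
    rw [← integral_complex_ofReal] at h'
    rw [hS]
    simp only
    rw [← Complex.ofReal_cpow hr.le, ← Complex.ofReal_mul, mul_comm (Real.Gamma p),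
      Real.rpow_neg hr.le, ← Real.inv_rpow hr.le, ← one_div, ← h']
    congr 1
    ext t
    push_cast
    ring
  refine hA.eqOn_of_preconnected_of_frequently_eq hB hconv.isPreconnected
    (z₀ := (1 : ℂ)) (by simp) ?_ hz
  have hmap : Tendsto (fun x : ℝ => (x : ℂ)) (𝓝[≠] 1) (𝓝[≠] 1) := by
    refine tendsto_nhdsWithin_of_tendsto_nhds_of_eventually_within _
      ((Complex.continuous_ofReal.tendsto 1).mono_left nhdsWithin_le_nhds) ?_
    filter_upwards [self_mem_nhdsWithin] with x hx
    simpa using hx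
  refine hmap.frequently (Eventually.frequently ?_)
  filter_upwards [nhdsWithin_le_nhds (lt_mem_nhds one_pos)] with x hx
  exact hreal x hx

end Laplace

/-! ### Boundary behaviour on the imaginary segment. -/

section BoundaryValues

variable {σ : ℝ}

/-- The limit on the imaginary segment `(-i, i)` of the real part of
`∫ (1 - t ^ 2)_+ ^ σ (ζ + i t) ^ (-2σ - 1) dt`. -/
noncomputable def bubbleLimit (σ : ℝ) : ℝ :=
  (2 * σ + 1) * (∫ t : ℝ, bubble σ t) * ∫ r in Set.Ioi (0 : ℝ), (1 + r ^ 2) ^ (-(σ + 1))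

lemma integral_bubble_nonneg (σ : ℝ) : 0 ≤ ∫ t : ℝ, bubble σ t :=
  integral_nonneg fun t => bubble_nonneg σ t

/-- `-(2σ + 1)` is the exponent produced by the radial integration; one differentiation lowers it to
`-(2σ + 2)`, where the closed form is available. -/
lemma hasDerivAt_bubblePower_closed (hσ : 0 < σ) {ζ : ℂ} (hζ : 0 < ζ.re) :
    HasDerivAt (bubblePower σ (-(2 * σ + 1)))
      (-(((2 * σ + 1) * ∫ t : ℝ, bubble σ t : ℝ) : ℂ) *
        (1 + ζ ^ 2) ^ ((-(σ + 1) : ℝ) : ℂ)) ζ := by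
  have h := hasDerivAt_bubblePower hσ (a := -(2 * σ + 1)) (by linarith) hζ
  have e : -(2 * σ + 1) - 1 = -(2 * σ + 2) := by ring
  rw [e, bubblePower_eq_mul_cpow hσ hζ] at h
  convert! h using 1
  push_cast
  ring

lemma tendsto_bubblePower_atTop (hσ : 0 < σ) :
    Tendsto (fun r : ℝ => bubblePower σ (-(2 * σ + 1)) r) atTop (𝓝 0) := by
  have h1 := tendsto_bubblePower_mul_rpow hσ (a := -(2 * σ + 1)) (by linarith)
  have h2 : Tendsto (fun r : ℝ => ((r ^ (-(2 * σ + 1)) : ℝ) : ℂ)) atTop (𝓝 0) := by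
    have := tendsto_rpow_neg_atTop (y := 2 * σ + 1) (by linarith)
    exact (Complex.continuous_ofReal.tendsto 0).comp this
  have h3 := h2.mul h1
  rw [zero_mul] at h3
  refine h3.congr' ?_
  filter_upwards [eventually_gt_atTop 0] with r hr
  rw [← mul_assoc, ← Complex.ofReal_mul, ← Real.rpow_add hr]
  simp

/-- Integrate the explicit derivative from `ε` to `+∞`, where the function vanishes. Positivity of
the integrand makes the values increase to `bubbleLimit σ` as `ε` decreases to `0`. -/
lemma bubblePower_ofReal (hσ : 0 < σ) {ε : ℝ} (hε : 0 < ε) :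
    bubblePower σ (-(2 * σ + 1)) ε = (((2 * σ + 1) * (∫ t : ℝ, bubble σ t) *
      ∫ r in Set.Ioi ε, (1 + r ^ 2) ^ (-(σ + 1)) : ℝ) : ℂ) := by
  have hint : IntegrableOn (fun r : ℝ => ((-((2 * σ + 1) * (∫ t : ℝ, bubble σ t) *
      (1 + r ^ 2) ^ (-(σ + 1))) : ℝ) : ℂ)) (Set.Ioi ε) :=
    (((integrable_one_add_sq_rpow (p := σ + 1) (by linarith)).const_mul _).neg).ofReal.integrableOn
  have h := integral_Ioi_of_hasDerivAt_of_tendsto'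
    (f := fun r : ℝ => bubblePower σ (-(2 * σ + 1)) r) (fun r hr => ?_) hint
    (tendsto_bubblePower_atTop hσ)
  · rw [integral_complex_ofReal, integral_neg, integral_const_mul] at h
    rw [zero_sub, Complex.ofReal_neg] at h
    exact (neg_injective h).symm
  · have hr : 0 < r := lt_of_lt_of_le hε hr
    convert! (hasDerivAt_bubblePower_closed hσ (ζ := r) (by simpa using hr)).comp_ofReal using 1
    have : (1 + (r : ℂ) ^ 2) = ((1 + r ^ 2 : ℝ) : ℂ) := by push_cast; ring
    rw [this, ← Complex.ofReal_cpow (by positivity)]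
    push_cast
    ring

lemma tendsto_bubblePower_zero (hσ : 0 < σ) :
    Tendsto (fun ε : ℝ => bubblePower σ (-(2 * σ + 1)) ε) (𝓝[>] 0) (𝓝 (bubbleLimit σ : ℂ)) := by
  have hint := integrable_one_add_sq_rpow (p := σ + 1) (by linarith)
  have h : Tendsto (fun ε : ℝ => ∫ r in Set.Ioi ε, (1 + r ^ 2) ^ (-(σ + 1))) (𝓝[>] 0)
      (𝓝 (∫ r in Set.Ioi (0 : ℝ), (1 + r ^ 2) ^ (-(σ + 1)))) := by
    have h1 : Tendsto (fun ε : ℝ => (∫ r in Set.Ioi (0 : ℝ), (1 + r ^ 2) ^ (-(σ + 1))) -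
        ∫ r in (0 : ℝ)..ε, (1 + r ^ 2) ^ (-(σ + 1))) (𝓝 0)
        (𝓝 ((∫ r in Set.Ioi (0 : ℝ), (1 + r ^ 2) ^ (-(σ + 1))) - 0)) := by
      refine tendsto_const_nhds.sub ?_
      have := (intervalIntegral.continuous_primitive
        (fun a b => hint.intervalIntegrable) 0).tendsto 0
      simpa using this
    rw [sub_zero] at h1
    refine (h1.mono_left nhdsWithin_le_nhds).congr' ?_
    filter_upwards [self_mem_nhdsWithin] with ε hε
    rw [← intervalIntegral.integral_Ioi_sub_Ioi hint.integrableOn (le_of_lt hε)]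
    ring
  have h2 := h.const_mul ((2 * σ + 1) * (∫ t : ℝ, bubble σ t))
  refine ((Complex.continuous_ofReal.tendsto _).comp h2).congr' ?_
  filter_upwards [self_mem_nhdsWithin] with ε hε
  exact (bubblePower_ofReal hσ hε).symm

lemma bubbleLimit_nonneg (hσ : 0 < σ) : 0 ≤ bubbleLimit σ :=
  mul_nonneg (mul_nonneg (by linarith) (integral_bubble_nonneg σ))
    (integral_nonneg fun r => by positivity)

lemma norm_bubblePower_ofReal_le (hσ : 0 < σ) {ε : ℝ} (hε : 0 < ε) :
    ‖bubblePower σ (-(2 * σ + 1)) ε‖ ≤ bubbleLimit σ := by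
  have hint := integrable_one_add_sq_rpow (p := σ + 1) (by linarith)
  have h0 : 0 ≤ (2 * σ + 1) * (∫ t : ℝ, bubble σ t) :=
    mul_nonneg (by linarith) (integral_bubble_nonneg σ)
  rw [bubblePower_ofReal hσ hε, Complex.norm_real, Real.norm_eq_abs, abs_of_nonneg
    (mul_nonneg h0 (integral_nonneg fun r => by positivity))]
  refine mul_le_mul_of_nonneg_left ?_ h0
  exact setIntegral_mono_set hint.integrableOn
    (Eventually.of_forall fun r => by simp only [Pi.zero_apply]; positivity)
    (LE.le.eventuallyLE (Set.Ioi_subset_Ioi hε.le))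

/-- Factor `1 + ζ ^ 2 = (ζ + i)(ζ - i)` and bound each factor by its imaginary part. The bound does
not involve `ε`, hence survives the limit. -/
lemma norm_one_add_sq_ge (ε τ : ℝ) : 1 - |τ| ≤ ‖1 + ((ε : ℂ) - τ * Complex.I) ^ 2‖ := by
  have e : 1 + ((ε : ℂ) - τ * Complex.I) ^ 2 =
      ((ε : ℂ) - τ * Complex.I + Complex.I) * ((ε : ℂ) - τ * Complex.I - Complex.I) := by
    linear_combination Complex.I_sq
  have h1 : |1 - τ| ≤ ‖(ε : ℂ) - τ * Complex.I + Complex.I‖ := by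
    refine le_trans (le_of_eq ?_) (Complex.abs_im_le_norm _)
    simp only [Complex.add_im, Complex.sub_im, Complex.ofReal_im, Complex.mul_im,
      Complex.ofReal_re, Complex.I_im, Complex.I_re]
    congr 1
    ring
  have h2 : |1 + τ| ≤ ‖(ε : ℂ) - τ * Complex.I - Complex.I‖ := by
    refine le_trans (le_of_eq ?_) (Complex.abs_im_le_norm _)
    simp only [Complex.sub_im, Complex.ofReal_im, Complex.mul_im,
      Complex.ofReal_re, Complex.I_im, Complex.I_re]
    rw [← abs_neg]
    congr 1
    ring
  rw [e, norm_mul]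
  refine le_trans ?_ (mul_le_mul h1 h2 (abs_nonneg _) (norm_nonneg _))
  rw [← abs_mul]
  rcases le_total 1 |τ| with h | h
  · exact (by linarith : 1 - |τ| ≤ 0).trans (abs_nonneg _)
  · refine le_trans ?_ (le_abs_self _)
    have := sq_abs τ
    nlinarith [abs_nonneg τ]

lemma re_sub_mul_I (ε τ : ℝ) : ((ε : ℂ) - τ * Complex.I).re = ε := by simp

lemma norm_one_add_sq_cpow_le (hσ : 0 < σ) (ε : ℝ) {τ : ℝ} (hτ : |τ| < 1) :
    ‖(1 + ((ε : ℂ) - τ * Complex.I) ^ 2) ^ ((-(σ + 1) : ℝ) : ℂ)‖ ≤ (1 - |τ|) ^ (-(σ + 1)) := by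
  rw [Complex.norm_cpow_real]
  exact Real.rpow_le_rpow_of_nonpos (by linarith) (norm_one_add_sq_ge ε τ) (by linarith)

lemma hasDerivAt_bubblePower_vertical (hσ : 0 < σ) {ε : ℝ} (hε : 0 < ε) (τ t : ℝ) :
    HasDerivAt (fun t : ℝ => bubblePower σ (-(2 * σ + 1)) (ε - (t * τ : ℝ) * Complex.I))
      ((((2 * σ + 1) * ∫ t : ℝ, bubble σ t : ℝ) : ℂ) *
        (1 + ((ε : ℂ) - (t * τ : ℝ) * Complex.I) ^ 2) ^ ((-(σ + 1) : ℝ) : ℂ) *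
          (τ * Complex.I)) t := by
  have h1 := hasDerivAt_bubblePower_closed hσ (ζ := ε - (t * τ : ℝ) * Complex.I)
    (by rw [re_sub_mul_I]; exact hε)
  have h2 : HasDerivAt (fun t : ℝ => (ε : ℂ) - (t * τ : ℝ) * Complex.I) (-(τ * Complex.I)) t := by
    have h3 : HasDerivAt (fun t : ℝ => t * τ) τ t := by
      simpa using (hasDerivAt_id t).mul_const τ
    exact (h3.ofReal_comp.mul_const Complex.I).const_sub (ε : ℂ)
  convert! h1.comp t h2 using 1
  ring

/-- Bound up to the boundary, uniform in `ε`. -/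
lemma norm_bubblePower_vertical_le (hσ : 0 < σ) {ε : ℝ} (hε : 0 < ε) {τ : ℝ} (hτ : |τ| < 1) :
    ‖bubblePower σ (-(2 * σ + 1)) (ε - τ * Complex.I)‖ ≤
      (bubbleLimit σ + (2 * σ + 1) * (∫ t : ℝ, bubble σ t) / σ) * (1 - |τ|) ^ (-σ) := by
  set M : ℝ := (2 * σ + 1) * ∫ t : ℝ, bubble σ t with hM
  have hM0 : 0 ≤ M := mul_nonneg (by linarith) (integral_bubble_nonneg σ)
  have hpos : ∀ t ∈ Set.Icc (0 : ℝ) 1, 0 < 1 - t * |τ| := fun t ht => by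
    nlinarith [ht.1, ht.2, abs_nonneg τ]
  -- The comparison function is the primitive of the bound on the derivative along the segment from
  -- `ε` to `ε - i τ`, started at the bound `bubbleLimit σ` for the value at `ε`.
  have hBd : ∀ t ∈ Set.Icc (0 : ℝ) 1,
      HasDerivAt (fun t : ℝ => bubbleLimit σ + M / σ * ((1 - t * |τ|) ^ (-σ) - 1))
        (M * |τ| * (1 - t * |τ|) ^ (-(σ + 1))) t := by
    intro t ht
    have h1 : HasDerivAt (fun t : ℝ => 1 - t * |τ|) (-|τ|) t := by
      have h3 : HasDerivAt (fun t : ℝ => t * |τ|) |τ| t := by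
        simpa using (hasDerivAt_id t).mul_const |τ|
      simpa using h3.const_sub 1
    have h2 := ((h1.rpow_const (p := -σ) (Or.inl (hpos t ht).ne')).sub_const 1).const_mul
      (M / σ) |>.const_add (bubbleLimit σ)
    convert! h2 using 1
    have : -σ - 1 = -(σ + 1) := by ring
    rw [this]
    field_simp
  have key := image_norm_le_of_norm_deriv_right_le_deriv_boundary' (a := 0) (b := 1)
    (f := fun t : ℝ => bubblePower σ (-(2 * σ + 1)) (ε - (t * τ : ℝ) * Complex.I))
    (fun t _ => (hasDerivAt_bubblePower_vertical hσ hε τ t).continuousAt.continuousWithinAt)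
    (fun t _ => (hasDerivAt_bubblePower_vertical hσ hε τ t).hasDerivWithinAt)
    (B := fun t : ℝ => bubbleLimit σ + M / σ * ((1 - t * |τ|) ^ (-σ) - 1))
    (by simpa using norm_bubblePower_ofReal_le hσ hε)
    (fun t ht => (hBd t ht).continuousAt.continuousWithinAt)
    (fun t ht => (hBd t (Set.Ico_subset_Icc_self ht)).hasDerivWithinAt) ?_
    (Set.right_mem_Icc.2 zero_le_one)
  · simp only [one_mul] at key
    refine key.trans ?_
    have h1 : 1 ≤ (1 - |τ|) ^ (-σ) :=
      Real.one_le_rpow_of_pos_of_le_one_of_nonpos (by linarith) (by linarith [abs_nonneg τ])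
        (by linarith)
    have h2 := mul_le_mul_of_nonneg_left h1 (bubbleLimit_nonneg hσ)
    have h3 : 0 ≤ M / σ := by positivity
    nlinarith
  · intro t ht
    have hlt : |t * τ| < 1 := by
      rw [abs_mul, abs_of_nonneg ht.1]
      linarith [hpos t (Set.Ico_subset_Icc_self ht)]
    have := norm_one_add_sq_cpow_le hσ ε hlt
    rw [abs_mul, abs_of_nonneg ht.1] at this
    rw [norm_mul, norm_mul, Complex.norm_real, Real.norm_eq_abs, abs_of_nonneg hM0, norm_mul,
      Complex.norm_real, Complex.norm_I, mul_one, Real.norm_eq_abs]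
    calc _ ≤ M * (1 - t * |τ|) ^ (-(σ + 1)) * |τ| := by gcongr
      _ = _ := by ring

/-- On the segment `(-i, i)` the number `1 + ζ ^ 2` is positive and `dζ` is imaginary, so moving
from `0` to `-i τ` changes the limit only by an imaginary amount. This is why the limit does not
depend on `τ`. -/
lemma tendsto_re_bubblePower (hσ : 0 < σ) {τ : ℝ} (hτ : |τ| < 1) :
    Tendsto (fun ε : ℝ => (bubblePower σ (-(2 * σ + 1)) (ε - τ * Complex.I)).re) (𝓝[>] 0)
      (𝓝 (bubbleLimit σ)) := by
  set M : ℝ := (2 * σ + 1) * ∫ t : ℝ, bubble σ t with hM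
  set D : ℝ → ℝ → ℂ := fun ε t => (M : ℂ) *
    (1 + ((ε : ℂ) - (t * τ : ℝ) * Complex.I) ^ 2) ^ ((-(σ + 1) : ℝ) : ℂ) *
          (τ * Complex.I) with hD
  -- The case `ε = 0` is included: there `1 + ζ ^ 2 = 1 - (t τ) ^ 2` is positive because `|τ| < 1`.
  -- It gives continuity of the integrand up to the boundary.
  have hslit : ∀ ε t : ℝ, 0 < ε ∨ (ε = 0 ∧ t ∈ Set.Icc (0 : ℝ) 1) →
      1 + ((ε : ℂ) - (t * τ : ℝ) * Complex.I) ^ 2 ∈ Complex.slitPlane := by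
    rintro ε t (h | ⟨rfl, ht⟩)
    · exact one_add_sq_mem_slitPlane (by rw [re_sub_mul_I]; exact h)
    · left
      have e : 1 + (((0 : ℝ) : ℂ) - (t * τ : ℝ) * Complex.I) ^ 2 =
          ((1 - (t * τ) ^ 2 : ℝ) : ℂ) := by
        push_cast
        linear_combination ((t : ℂ) * τ) ^ 2 * Complex.I_sq
      rw [e, Complex.ofReal_re]
      have : |t * τ| < 1 := by
        rw [abs_mul, abs_of_nonneg ht.1]
        nlinarith [ht.1, ht.2, abs_nonneg τ]
      have := sq_lt_one_iff_abs_lt_one (t * τ) |>.2 this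
      linarith
  have hcont : ∀ ε : ℝ, 0 < ε → Continuous (D ε) := by
    intro ε hε
    refine (continuous_const.mul ?_).mul continuous_const
    exact Continuous.cpow (by fun_prop) continuous_const fun t => hslit ε t (Or.inl hε)
  have hFTC : ∀ ε : ℝ, 0 < ε → bubblePower σ (-(2 * σ + 1)) (ε - τ * Complex.I) =
      bubblePower σ (-(2 * σ + 1)) ε + ∫ t in (0 : ℝ)..1, D ε t := by
    intro ε hε
    rw [intervalIntegral.integral_eq_sub_of_hasDerivAt
      (fun t _ => hasDerivAt_bubblePower_vertical hσ hε τ t)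
      ((hcont ε hε).intervalIntegrable _ _)]
    simp
  have hbound : ∀ ε : ℝ, ∀ t ∈ Set.Icc (0 : ℝ) 1,
      ‖D ε t‖ ≤ M * (1 - |τ|) ^ (-(σ + 1)) * |τ| := by
    intro ε t ht
    have hle : |t * τ| ≤ |τ| := by
      rw [abs_mul, abs_of_nonneg ht.1]
      nlinarith [ht.1, ht.2, abs_nonneg τ]
    have := norm_one_add_sq_cpow_le hσ ε (hle.trans_lt hτ)
    have h2 : (1 - |t * τ|) ^ (-(σ + 1)) ≤ (1 - |τ|) ^ (-(σ + 1)) :=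
      Real.rpow_le_rpow_of_nonpos (by linarith) (by linarith) (by linarith)
    have hM0 : 0 ≤ M := mul_nonneg (by linarith) (integral_bubble_nonneg σ)
    rw [hD]
    simp only
    rw [norm_mul, norm_mul, Complex.norm_real, Real.norm_eq_abs, abs_of_nonneg hM0, norm_mul,
      Complex.norm_real, Complex.norm_I, mul_one, Real.norm_eq_abs]
    gcongr
    exact this.trans h2
  have hlim : Tendsto (fun ε : ℝ => ∫ t in (0 : ℝ)..1, D ε t) (𝓝[>] 0)
      (𝓝 (∫ t in (0 : ℝ)..1, D 0 t)) := by
    refine intervalIntegral.tendsto_integral_filter_of_dominated_convergence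
      (fun _ => M * (1 - |τ|) ^ (-(σ + 1)) * |τ|) ?_ ?_ intervalIntegrable_const ?_
    · filter_upwards [self_mem_nhdsWithin] with ε hε
      exact (hcont ε hε).aestronglyMeasurable
    · refine Eventually.of_forall fun ε => Eventually.of_forall fun t ht => hbound ε t ?_
      rw [Set.uIoc_of_le zero_le_one] at ht
      exact Set.Ioc_subset_Icc_self ht
    · refine Eventually.of_forall fun t ht => ?_
      rw [Set.uIoc_of_le zero_le_one] at ht
      have h1 : ContinuousAt (fun ε : ℝ => D ε t) 0 := by
        refine (continuousAt_const.mul ?_).mul continuousAt_const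
        exact ContinuousAt.cpow (by fun_prop) continuousAt_const
          (hslit 0 t (Or.inr ⟨rfl, Set.Ioc_subset_Icc_self ht⟩))
      exact h1.tendsto.mono_left nhdsWithin_le_nhds
  have hre : (∫ t in (0 : ℝ)..1, D 0 t).re = 0 := by
    have e : ∫ t in (0 : ℝ)..1, D 0 t = ((∫ t in (0 : ℝ)..1,
        M * (1 - (t * τ) ^ 2) ^ (-(σ + 1)) * τ : ℝ) : ℂ) * Complex.I := by
      rw [← intervalIntegral.integral_ofReal, ← intervalIntegral.integral_mul_const]
      refine intervalIntegral.integral_congr fun t ht => ?_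
      rw [Set.uIcc_of_le zero_le_one] at ht
      have e : 1 + (((0 : ℝ) : ℂ) - (t * τ : ℝ) * Complex.I) ^ 2 =
          ((1 - (t * τ) ^ 2 : ℝ) : ℂ) := by
        push_cast
        linear_combination ((t : ℂ) * τ) ^ 2 * Complex.I_sq
      have h0 : 0 ≤ 1 - (t * τ) ^ 2 := by
        have := hslit 0 t (Or.inr ⟨rfl, ht⟩)
        rw [e, Complex.ofReal_mem_slitPlane] at this
        exact this.le
      simp only [hD]
      rw [e, ← Complex.ofReal_cpow h0]
      push_cast
      ring
    rw [e]
    simp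
  have h := (tendsto_bubblePower_zero hσ).add hlim
  have h2 := (Complex.continuous_re.tendsto _).comp h
  rw [Complex.add_re, Complex.ofReal_re, hre, add_zero] at h2
  refine h2.congr' ?_
  filter_upwards [self_mem_nhdsWithin] with ε hε
  simp only [Function.comp]
  rw [hFTC ε hε]

end BoundaryValues

/-! ### Marginals and total mass of the profile. -/

section Marginal

variable {F : Type*} [NormedAddCommGroup F] [NormedSpace ℝ F]

/-- The total mass of the profile `(1 - ‖x‖ ^ 2)_+ ^ s` in dimension `m`. -/
noncomputable def bubbleMass (m : ℕ) (s : ℝ) : ℝ := ∫ x : EuclideanSpace ℝ (Fin m), bubble s x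

lemma bubbleMass_nonneg (m : ℕ) (s : ℝ) : 0 ≤ bubbleMass m s :=
  integral_nonneg fun x => bubble_nonneg s x

lemma bubble_smul_continuous_integrable {E : Type*} [NormedAddCommGroup E] [ProperSpace E]
    [MeasurableSpace E] [BorelSpace E] {μ : Measure E} [IsFiniteMeasureOnCompacts μ] {s : ℝ}
    (hs : 0 < s) {f : E → F} (hf : Continuous f) : Integrable (fun x => bubble s x • f x) μ :=
  ((continuous_bubble hs).smul hf).integrable_of_hasCompactSupport
    (hasCompactSupport_bubble hs).smul_right

lemma integral_euclideanSpace_succ {m : ℕ} {g : EuclideanSpace ℝ (Fin (m + 1)) → F}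
    (hg : Integrable g) :
    ∫ y, g y = ∫ t : ℝ, ∫ z : EuclideanSpace ℝ (Fin m), g (WithLp.toLp 2 (Fin.cons t z.ofLp)) := by
  have h1 := (EuclideanSpace.volume_preserving_symm_measurableEquiv_toLp (Fin (m + 1))).symm
  have h2 := (volume_preserving_piFinSuccAbove (fun _ : Fin (m + 1) => ℝ) 0).symm
  have h12 := h1.comp h2
  have hemb : MeasurableEmbedding
    (((MeasurableEquiv.toLp 2 (Fin (m + 1) → ℝ)).symm.symm) ∘
      (MeasurableEquiv.piFinSuccAbove (fun _ : Fin (m + 1) => ℝ) 0).symm) :=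
    (MeasurableEquiv.measurableEmbedding _).comp (MeasurableEquiv.measurableEmbedding _)
  rw [← h12.integral_comp hemb]
  have hint := h12.integrable_comp_of_integrable hg
  rw [Measure.volume_eq_prod] at hint ⊢
  refine (integral_prod _ hint).trans ?_
  congr 1
  ext t
  have h3 := (EuclideanSpace.volume_preserving_symm_measurableEquiv_toLp (Fin m)).symm
  rw [← h3.integral_comp (MeasurableEquiv.measurableEmbedding _)]
  congr 1
  ext y
  have e : (MeasurableEquiv.piFinSuccAbove (fun _ : Fin (m + 1) => ℝ) 0).symm (t, y) =
      Fin.cons t y := by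
    simp [MeasurableEquiv.piFinSuccAbove, Fin.consEquiv]
  simp only [Function.comp, e]
  rfl

lemma norm_toLp_cons_sq {m : ℕ} (t : ℝ) (z : EuclideanSpace ℝ (Fin m)) :
    ‖(WithLp.toLp 2 (Fin.cons t z.ofLp) : EuclideanSpace ℝ (Fin (m + 1)))‖ ^ 2 =
      t ^ 2 + ‖z‖ ^ 2 := by
  rw [EuclideanSpace.norm_sq_eq, EuclideanSpace.norm_sq_eq, Fin.sum_univ_succ]
  simp

/-- The slice at height `t` is a ball of radius `ρ = √(1 - t ^ 2)`. Rescaling it to the unit ball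
contributes `(1 - t ^ 2) ^ s` from the profile and `ρ ^ m` from the volume, whence the exponent `s +
m / 2`. -/
lemma integral_bubble_cons {m : ℕ} {s : ℝ} (hs : 0 < s) (t : ℝ) :
    ∫ z : EuclideanSpace ℝ (Fin m), bubble s
      (WithLp.toLp 2 (Fin.cons t z.ofLp) : EuclideanSpace ℝ (Fin (m + 1))) =
      bubbleMass m s * bubble (s + m / 2) t := by
  have hm : 0 ≤ (m : ℝ) / 2 := by positivity
  rcases lt_or_ge |t| 1 with ht | ht
  · have hpos : 0 < 1 - t ^ 2 := by
      have := (sq_lt_one_iff_abs_lt_one t).2 ht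
      linarith
    set ρ := Real.sqrt (1 - t ^ 2) with hρ
    have hρ0 : 0 < ρ := Real.sqrt_pos.2 hpos
    have hρ2 : ρ ^ 2 = 1 - t ^ 2 := Real.sq_sqrt hpos.le
    have e : ∀ z : EuclideanSpace ℝ (Fin m), bubble s
        (WithLp.toLp 2 (Fin.cons t z.ofLp) : EuclideanSpace ℝ (Fin (m + 1))) =
        (1 - t ^ 2) ^ s * bubble s (ρ⁻¹ • z) := by
      intro z
      rw [bubble, bubble, norm_toLp_cons_sq, ← Real.mul_rpow hpos.le (le_max_left _ _),
        mul_max_of_nonneg _ _ hpos.le, mul_zero, norm_smul, mul_pow, norm_inv, inv_pow,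
        Real.norm_eq_abs, sq_abs, hρ2]
      congr 2
      field_simp
      ring
    simp_rw [e]
    rw [integral_const_mul, Measure.integral_comp_inv_smul_of_nonneg _ _ hρ0.le,
      finrank_euclideanSpace_fin, bubble_of_norm_le_one _ (by simpa using ht.le),
      Real.norm_eq_abs, sq_abs, Real.rpow_add hpos, bubbleMass, smul_eq_mul]
    have : ρ ^ m = (1 - t ^ 2) ^ ((m : ℝ) / 2) := by
      rw [hρ, Real.sqrt_eq_rpow, ← Real.rpow_natCast, ← Real.rpow_mul hpos.le]
      congr 1
      ring
    rw [this]
    ring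
  · rw [bubble_of_one_le (by linarith) (by simpa using ht), mul_zero]
    rw [← integral_zero (EuclideanSpace ℝ (Fin m)) ℝ]
    congr 1
    ext z
    refine bubble_of_one_le hs ?_
    have h1 := norm_toLp_cons_sq t z
    have h2 : 1 ≤ t ^ 2 := by rw [← sq_abs]; nlinarith
    nlinarith [norm_nonneg z, norm_nonneg
      (WithLp.toLp 2 (Fin.cons t z.ofLp) : EuclideanSpace ℝ (Fin (m + 1)))]

lemma integral_bubble_smul_coord [CompleteSpace F] {m : ℕ} {s : ℝ} (hs : 0 < s) {f : ℝ → F}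
    (hf : Continuous f) :
    ∫ y : EuclideanSpace ℝ (Fin (m + 1)), bubble s y • f (y 0) =
      bubbleMass m s • ∫ t : ℝ, bubble (s + m / 2) t • f t := by
  rw [integral_euclideanSpace_succ (bubble_smul_continuous_integrable hs (by fun_prop)),
    ← integral_smul]
  congr 1
  ext t
  simp only [Fin.cons_zero]
  rw [integral_smul_const, integral_bubble_cons hs, mul_smul]

/-- The marginal of `(1 - ‖x‖ ^ 2)_+ ^ s` in a given direction. -/
lemma integral_bubble_smul_inner [CompleteSpace F] {m : ℕ} {s : ℝ} (hs : 0 < s) {f : ℝ → F}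
    (hf : Continuous f) {e : EuclideanSpace ℝ (Fin (m + 1))} (he : ‖e‖ = 1) :
    ∫ y : EuclideanSpace ℝ (Fin (m + 1)), bubble s y • f (inner ℝ e y) =
      bubbleMass m s • ∫ t : ℝ, bubble (s + m / 2) t • f t := by
  -- The profile is rotation invariant, so an orthonormal basis with first vector `e` reduces the
  -- claim to the coordinate direction.
  obtain ⟨b, hb⟩ := Orthonormal.exists_orthonormalBasis_extension_of_card_eq (𝕜 := ℝ)
    (ι := Fin (m + 1)) (E := EuclideanSpace ℝ (Fin (m + 1))) (by simp) (v := fun _ => e)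
    (s := {0}) (by
      constructor
      · rintro ⟨i, hi⟩
        simpa using he
      · rintro ⟨i, hi⟩ ⟨j, hj⟩ hij
        exact absurd (Subtype.ext ((Set.mem_singleton_iff.1 hi).trans
          (Set.mem_singleton_iff.1 hj).symm)) hij)
  have hb0 : b 0 = e := hb 0 rfl
  rw [← integral_bubble_smul_coord hs hf]
  rw [← b.repr.measurePreserving.integral_comp b.repr.toHomeomorph.measurableEmbedding
    (fun y : EuclideanSpace ℝ (Fin (m + 1)) => bubble s y • f (y 0))]
  congr 1
  ext y
  rw [b.repr_apply_apply, hb0]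
  simp [bubble]

lemma bubbleMass_succ {s : ℝ} (hs : 0 < s) (m : ℕ) :
    bubbleMass (m + 1) s = bubbleMass m s * ∫ t : ℝ, bubble (s + m / 2) t := by
  have := integral_bubble_smul_coord (F := ℝ) (m := m) hs (f := fun _ => 1) continuous_const
  simpa [bubbleMass] using this

/-- Induction on the dimension: each added coordinate multiplies the mass by a one-dimensional
integral, and the Gamma quotients telescope. -/
lemma bubbleMass_eq {s : ℝ} (hs : 0 < s) (m : ℕ) :
    bubbleMass m s = Real.sqrt Real.pi ^ m * Real.Gamma (s + 1) / Real.Gamma (s + 1 + m / 2) := by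
  induction m with
  | zero =>
    have h0 : 0 < Real.Gamma (s + 1) := Real.Gamma_pos_of_pos (by linarith)
    have h1 : (volume : Measure (EuclideanSpace ℝ (Fin 0))) Set.univ = 1 := by
      have := EuclideanSpace.volume_preserving_symm_measurableEquiv_toLp (Fin 0)
      rw [← Set.preimage_univ (f := (MeasurableEquiv.toLp 2 (Fin 0 → ℝ)).symm),
        this.measure_preimage MeasurableSet.univ.nullMeasurableSet]
      simp [volume_pi]
    have h2 : ∀ x : EuclideanSpace ℝ (Fin 0), bubble s x = 1 := by
      intro x
      rw [Subsingleton.elim x 0]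
      simp [bubble]
    simp_rw [bubbleMass, h2]
    simp [measureReal_def, h1, h0.ne']
  | succ m ih =>
    have hm : 0 ≤ (m : ℝ) / 2 := by positivity
    have h0 : 0 < Real.Gamma (s + 1 + m / 2) := Real.Gamma_pos_of_pos (by linarith)
    rw [bubbleMass_succ hs, ih, integral_bubble_real (by linarith)]
    have e1 : s + (m : ℝ) / 2 + 1 = s + 1 + m / 2 := by ring
    have e2 : s + (m : ℝ) / 2 + 3 / 2 = s + 1 + ((m + 1 : ℕ) : ℝ) / 2 := by push_cast; ring
    rw [e1, e2]
    field_simp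
    ring

end Marginal

/-! ### Polar coordinates for vector-valued integrals. -/

section Polar

variable {E F : Type*} [NormedAddCommGroup E] [NormedSpace ℝ E] [MeasurableSpace E] [BorelSpace E]
  [FiniteDimensional ℝ E] [Nontrivial E] (μ : Measure E) [μ.IsAddHaarMeasure]
  [NormedAddCommGroup F] [NormedSpace ℝ F]

/-- Integration in polar coordinates. -/
lemma integral_eq_integral_toSphere {f : E → F} (hf : Integrable f μ) :
    ∫ x, f x ∂μ = ∫ w : sphere (0 : E) 1, ∫ r in Set.Ioi (0 : ℝ),
      r ^ (Module.finrank ℝ E - 1) • f (r • (w : E)) ∂volume ∂μ.toSphere := by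
  have hmp := μ.measurePreserving_homeomorphUnitSphereProd.symm
    (homeomorphUnitSphereProd E).toMeasurableEquiv
  have hemb : MeasurableEmbedding (homeomorphUnitSphereProd E).toMeasurableEquiv.symm :=
    MeasurableEquiv.measurableEmbedding _
  have hint : Integrable (fun x : ({(0)}ᶜ : Set E) => f x) (μ.comap (↑)) := by
    have := hf.integrableOn (s := ({0} : Set E)ᶜ)
    exact (integrableOn_iff_comap_subtypeVal (measurableSet_singleton _).compl).1 this
  have h1 : ∫ x, f x ∂μ = ∫ x : ({(0)}ᶜ : Set E), f x ∂(μ.comap (↑)) := by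
    rw [integral_subtype_comap (measurableSet_singleton _).compl f,
      restrict_compl_singleton]
  rw [h1, ← hmp.integral_comp hemb]
  have hint2 := hmp.integrable_comp_of_integrable hint
  refine (integral_prod _ hint2).trans ?_
  congr 1
  ext w
  simp only [Measure.volumeIoiPow, ENNReal.ofReal]
  rw [integral_withDensity_eq_integral_smul]
  · rw [← integral_subtype_comap measurableSet_Ioi
      (fun r : ℝ => r ^ (Module.finrank ℝ E - 1) • f (r • (w : E)))]
    refine integral_congr_ae (Eventually.of_forall fun r => ?_)
    have hr : 0 < (r : ℝ) := r.2
    simp only [NNReal.smul_def, Real.coe_toNNReal _ (pow_nonneg hr.le _)]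
    rfl
  · exact (measurable_subtype_coe.pow_const _).real_toNNReal

end Polar

lemma ofReal_mul_cpow {r : ℝ} (hr : 0 < r) {z : ℂ} (hz : z ≠ 0) (a : ℂ) :
    ((r : ℂ) * z) ^ a = (r : ℂ) ^ a * z ^ a := by
  have hr' : (r : ℂ) ≠ 0 := by exact_mod_cast hr.ne'
  rw [Complex.cpow_def_of_ne_zero (mul_ne_zero hr' hz), Complex.cpow_def_of_ne_zero hr',
    Complex.cpow_def_of_ne_zero hz, Complex.log_ofReal_mul hr hz, ← Complex.exp_add,
    Complex.ofReal_log hr.le]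
  ring_nf

/-! ### The regularized kernel as a spherical mean. -/

section Kernel

variable {m : ℕ} {s : ℝ}

lemma fourier_ofReal_apply {E : Type*} [NormedAddCommGroup E] [InnerProductSpace ℝ E]
    [MeasurableSpace E] [BorelSpace E] [FiniteDimensional ℝ E] (f : E → ℝ) (ξ : E) :
    𝓕 (fun x => (f x : ℂ)) ξ =
      ∫ x, f x • Complex.exp (-((2 * Real.pi * inner ℝ x ξ : ℝ) * Complex.I)) := by
  rw [Real.fourier_eq']
  congr 1
  ext x
  rw [smul_eq_mul, mul_comm, Complex.real_smul]
  congr 2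
  push_cast
  ring

lemma conj_fourier_ofReal {E : Type*} [NormedAddCommGroup E] [InnerProductSpace ℝ E]
    [MeasurableSpace E] [BorelSpace E] [FiniteDimensional ℝ E] (f : E → ℝ) (ξ : E) :
    conj (𝓕 (fun x => (f x : ℂ)) ξ) =
      ∫ x, f x • Complex.exp ((2 * Real.pi * inner ℝ x ξ : ℝ) * Complex.I) := by
  rw [fourier_ofReal_apply, ← integral_conj]
  congr 1
  ext x
  rw [Complex.real_smul, Complex.real_smul, map_mul, Complex.conj_ofReal, ← Complex.exp_conj]
  congr 2
  rw [map_neg, map_mul, Complex.conj_ofReal, Complex.conj_I]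
  ring

lemma fourier_ofReal_neg {E : Type*} [NormedAddCommGroup E] [InnerProductSpace ℝ E]
    [MeasurableSpace E] [BorelSpace E] [FiniteDimensional ℝ E] (f : E → ℝ) (ξ : E) :
    𝓕 (fun x => (f x : ℂ)) (-ξ) = conj (𝓕 (fun x => (f x : ℂ)) ξ) := by
  rw [conj_fourier_ofReal, fourier_ofReal_apply]
  congr 1
  ext x
  rw [inner_neg_right]
  congr 2
  push_cast
  ring

/-- The regularized symbol `(2π‖ξ‖) ^ (2s) exp (-2πε‖ξ‖)`. -/
noncomputable def dampedSymbol {E : Type*} [Norm E] (s ε : ℝ) (ξ : E) : ℝ :=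
  (2 * Real.pi * ‖ξ‖) ^ (2 * s) * Real.exp (-(2 * Real.pi * ‖ξ‖ * ε))

lemma dampedSymbol_nonneg {E : Type*} [NormedAddCommGroup E] (s ε : ℝ) (ξ : E) :
    0 ≤ dampedSymbol s ε ξ := by
  unfold dampedSymbol
  positivity

lemma continuous_dampedSymbol {E : Type*} [NormedAddCommGroup E] (hs : 0 < s) (ε : ℝ) :
    Continuous (dampedSymbol s ε : E → ℝ) := by
  unfold dampedSymbol
  refine Continuous.mul ?_ (by fun_prop)
  exact (by fun_prop : Continuous fun ξ : E => 2 * Real.pi * ‖ξ‖).rpow_const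
    fun _ => Or.inr (by linarith)

/-- Absorbs the polar weight `r ^ m`; the exponent is written as `(2s + m + 1) - 1` to match the
Gamma integral. -/
lemma pow_mul_dampedSymbol (s ε : ℝ) (m : ℕ) {r : ℝ} (hr : 0 < r) :
    r ^ m * dampedSymbol s ε r = (2 * Real.pi) ^ (2 * s) *
      (r ^ ((2 * s + m + 1) - 1) * Real.exp (-(2 * Real.pi * ε * r))) := by
  have h1 : r ^ ((2 * s + m + 1) - 1) = r ^ (2 * s) * r ^ m := by
    rw [← Real.rpow_natCast, ← Real.rpow_add hr]
    congr 1
    ring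
  rw [dampedSymbol, Real.norm_eq_abs, abs_of_pos hr, Real.mul_rpow (by positivity) hr.le, h1]
  have h2 : 2 * Real.pi * ε * r = 2 * Real.pi * r * ε := by ring
  rw [h2]
  ring

lemma integrableOn_pow_mul_dampedSymbol (hs : 0 < s) {ε : ℝ} (hε : 0 < ε) (m : ℕ) :
    IntegrableOn (fun r : ℝ => r ^ m * dampedSymbol s ε r) (Set.Ioi 0) := by
  have h := (integrableOn_rpow_mul_exp_neg (b := (2 * s + m + 1) - 1) (c := 2 * Real.pi * ε)
    (by have : (0 : ℝ) ≤ m := by positivity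
        linarith) (by positivity)).const_mul ((2 * Real.pi) ^ (2 * s))
  exact IntegrableOn.congr_fun h (fun r hr => (pow_mul_dampedSymbol s ε m hr).symm) measurableSet_Ioi

lemma integrable_dampedSymbol (hs : 0 < s) {ε : ℝ} (hε : 0 < ε) :
    Integrable (dampedSymbol s ε : EuclideanSpace ℝ (Fin (m + 1)) → ℝ) := by
  have h := (integrable_fun_norm_addHaar (E := EuclideanSpace ℝ (Fin (m + 1))) volume
    (f := fun r : ℝ => dampedSymbol s ε r)).2 (by
      simpa using integrableOn_pow_mul_dampedSymbol hs hε m)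
  refine h.congr (Eventually.of_forall fun ξ => ?_)
  simp [dampedSymbol]

lemma norm_fourier_bubble_le (s : ℝ) (ξ : EuclideanSpace ℝ (Fin m)) :
    ‖𝓕 (fun x : EuclideanSpace ℝ (Fin m) => (bubble s x : ℂ)) ξ‖ ≤ bubbleMass m s := by
  rw [fourier_ofReal_apply]
  refine (norm_integral_le_integral_norm _).trans (le_of_eq ?_)
  rw [bubbleMass]
  congr 1
  ext x
  rw [norm_smul, ← neg_mul, ← Complex.ofReal_neg, Complex.norm_exp_ofReal_mul_I, mul_one,
    Real.norm_eq_abs, abs_of_nonneg (bubble_nonneg s x)]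

lemma continuous_fourier_bubble (hs : 0 < s) :
    Continuous (𝓕 (fun x : EuclideanSpace ℝ (Fin m) => (bubble s x : ℂ))) :=
  VectorFourier.fourierIntegral_continuous Real.continuous_fourierChar continuous_inner
    (integrable_bubble hs).ofReal

/-- Projection-slice principle: along the line through `w` the transform only sees the marginal in
the direction `w`. -/
lemma fourier_bubble_smul (hs : 0 < s) (r : ℝ) {w : EuclideanSpace ℝ (Fin (m + 1))}
    (hw : ‖w‖ = 1) :
    𝓕 (fun x : EuclideanSpace ℝ (Fin (m + 1)) => (bubble s x : ℂ)) (r • w) =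
      bubbleMass m s * ∫ t : ℝ, bubble (s + m / 2) t •
        Complex.exp (-((2 * Real.pi * (r * t) : ℝ) * Complex.I)) := by
  rw [fourier_ofReal_apply, ← Complex.real_smul, ← integral_bubble_smul_inner hs
    (f := fun t : ℝ => Complex.exp (-((2 * Real.pi * (r * t) : ℝ) * Complex.I))) (by fun_prop) hw]
  congr 1
  ext x
  rw [real_inner_smul_right, real_inner_comm]

/-- The regularization of `(-Δ)^s` applied to the profile `(1 - ‖x‖ ^ 2)_+ ^ s`. -/
noncomputable def dampedKernel (m : ℕ) (s ε : ℝ) (x : EuclideanSpace ℝ (Fin (m + 1))) : ℂ :=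
  ∫ ξ : EuclideanSpace ℝ (Fin (m + 1)), (dampedSymbol s ε ξ : ℂ) *
    𝓕 (fun x : EuclideanSpace ℝ (Fin (m + 1)) => (bubble s x : ℂ)) ξ *
      Complex.exp ((2 * Real.pi * inner ℝ x ξ : ℝ) * Complex.I)

lemma integrable_dampedSymbol_mul_fourier (hs : 0 < s) {ε : ℝ} (hε : 0 < ε) :
    Integrable fun ξ : EuclideanSpace ℝ (Fin (m + 1)) => (dampedSymbol s ε ξ : ℂ) *
      𝓕 (fun x : EuclideanSpace ℝ (Fin (m + 1)) => (bubble s x : ℂ)) ξ :=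
  (integrable_dampedSymbol hs hε).ofReal.mul_bdd
    (continuous_fourier_bubble hs).aestronglyMeasurable
    (Eventually.of_forall fun ξ => norm_fourier_bubble_le s ξ)

lemma integrable_dampedKernel_integrand (hs : 0 < s) {ε : ℝ} (hε : 0 < ε)
    (x : EuclideanSpace ℝ (Fin (m + 1))) :
    Integrable fun ξ : EuclideanSpace ℝ (Fin (m + 1)) => (dampedSymbol s ε ξ : ℂ) *
      𝓕 (fun x : EuclideanSpace ℝ (Fin (m + 1)) => (bubble s x : ℂ)) ξ *
        Complex.exp ((2 * Real.pi * inner ℝ x ξ : ℝ) * Complex.I) :=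
  (integrable_dampedSymbol_mul_fourier hs hε).mul_bdd (c := 1)
    (by fun_prop : Continuous fun ξ : EuclideanSpace ℝ (Fin (m + 1)) =>
      Complex.exp ((2 * Real.pi * inner ℝ x ξ : ℝ) * Complex.I)).aestronglyMeasurable
    (Eventually.of_forall fun ξ => by rw [Complex.norm_exp_ofReal_mul_I])

/-- The symbol is even and the transform of a real function is Hermitian, so `ξ ↦ -ξ` conjugates the
integrand. Thus only the real part of the spherical mean contributes. -/
lemma conj_dampedKernel (ε : ℝ) (x : EuclideanSpace ℝ (Fin (m + 1))) :
    conj (dampedKernel m s ε x) = dampedKernel m s ε x := by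
  rw [dampedKernel, ← integral_conj, ← integral_neg_eq_self]
  congr 1
  ext ξ
  rw [map_mul, map_mul, fourier_ofReal_neg, Complex.conj_ofReal, Complex.conj_conj,
    ← Complex.exp_conj, map_mul, Complex.conj_ofReal, Complex.conj_I, inner_neg_right]
  congr 2
  · simp [dampedSymbol]
  · push_cast
    ring

/-- The constant relating the regularized kernel to one-dimensional integrals. -/
noncomputable def kernelConst (m : ℕ) (s : ℝ) : ℝ :=
  bubbleMass m s * ((2 * Real.pi) ^ (-((m : ℝ) + 1)) * Real.Gamma (2 * s + m + 1))

/-- After exchanging the integrals, the `r`-integral is a Gamma integral with complex parameter `2π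
(ε - i τ + i t)` and exponent `2s + m + 1 = 2σ + 1`, where `σ = s + m / 2`. The powers of `2π`
combine to `(2π) ^ (-(m + 1))`. -/
lemma integral_radial_dampedKernel (hs : 0 < s) {ε : ℝ} (hε : 0 < ε) (τ : ℝ) :
    ∫ r in Set.Ioi (0 : ℝ), r ^ m • ((dampedSymbol s ε r : ℂ) *
      (bubbleMass m s * ∫ t : ℝ, bubble (s + m / 2) t •
        Complex.exp (-((2 * Real.pi * (r * t) : ℝ) * Complex.I))) *
        Complex.exp ((2 * Real.pi * (r * τ) : ℝ) * Complex.I)) =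
    kernelConst m s * bubblePower (s + m / 2) (-(2 * (s + m / 2) + 1)) (ε - τ * Complex.I) := by
  have hm : (0 : ℝ) ≤ m := by positivity
  have hσ : 0 < s + m / 2 := by positivity
  set f : ℝ → ℝ → ℂ := fun r t => ((r ^ m * dampedSymbol s ε r : ℝ) : ℂ) * bubbleMass m s *
    ((bubble (s + m / 2) t : ℂ) *
      Complex.exp ((2 * Real.pi * (r * (τ - t)) : ℝ) * Complex.I)) with hf
  have h1 : ∀ r : ℝ, r ^ m • ((dampedSymbol s ε r : ℂ) *
      (bubbleMass m s * ∫ t : ℝ, bubble (s + m / 2) t •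
        Complex.exp (-((2 * Real.pi * (r * t) : ℝ) * Complex.I))) *
        Complex.exp ((2 * Real.pi * (r * τ) : ℝ) * Complex.I)) = ∫ t, f r t := by
    intro r
    simp only [hf]
    rw [integral_const_mul, Complex.real_smul]
    have : ∀ t : ℝ, (bubble (s + m / 2) t : ℂ) *
        Complex.exp ((2 * Real.pi * (r * (τ - t)) : ℝ) * Complex.I) =
        (bubble (s + m / 2) t •
        Complex.exp (-((2 * Real.pi * (r * t) : ℝ) * Complex.I))) *
        Complex.exp ((2 * Real.pi * (r * τ) : ℝ) * Complex.I) := by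
      intro t
      rw [Complex.real_smul, mul_assoc (bubble (s + m / 2) t : ℂ), ← Complex.exp_add]
      congr 2
      push_cast
      ring
    simp_rw [this]
    rw [integral_mul_const]
    push_cast
    ring
  have hint : Integrable (Function.uncurry f)
      ((volume.restrict (Set.Ioi (0 : ℝ))).prod volume) := by
    have hb : Integrable (fun z : ℝ × ℝ => ((z.1 ^ m * dampedSymbol s ε z.1 : ℝ) : ℂ) *
        (bubble (s + m / 2) z.2 : ℂ)) ((volume.restrict (Set.Ioi (0 : ℝ))).prod volume) :=
      Integrable.mul_prod (f := fun r : ℝ => ((r ^ m * dampedSymbol s ε r : ℝ) : ℂ))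
        (g := fun t : ℝ => (bubble (s + m / 2) t : ℂ))
        (integrableOn_pow_mul_dampedSymbol hs hε m).ofReal (integrable_bubble hσ).ofReal
    have hb2 := (hb.const_mul (bubbleMass m s : ℂ)).mul_bdd (c := 1)
      (by fun_prop : Continuous fun z : ℝ × ℝ =>
        Complex.exp ((2 * Real.pi * (z.1 * (τ - z.2)) : ℝ) * Complex.I)).aestronglyMeasurable
      (Eventually.of_forall fun z => by rw [Complex.norm_exp_ofReal_mul_I])
    refine hb2.congr (Eventually.of_forall fun z => ?_)
    simp only [Function.uncurry, hf]
    ring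
  simp_rw [h1]
  rw [integral_integral_swap hint, bubblePower, ← integral_const_mul]
  congr 1
  ext t
  have hz : 0 < ((ε : ℂ) - τ * Complex.I + t * Complex.I).re := by simpa using hε
  set z : ℂ := (ε : ℂ) - τ * Complex.I + t * Complex.I with hzdef
  have hz0 : z ≠ 0 := by
    intro h
    rw [h] at hz
    simp at hz
  have h2pi : 0 < 2 * Real.pi := by positivity
  have h2 : ∀ r ∈ Set.Ioi (0 : ℝ), f r t = ((2 * Real.pi) ^ (2 * s) : ℝ) * bubbleMass m s *
      (bubble (s + m / 2) t : ℂ) * (((r ^ ((2 * s + m + 1) - 1) : ℝ) : ℂ) *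
        Complex.exp (-((((2 * Real.pi : ℝ) : ℂ) * z) * r))) := by
    intro r hr
    have e : Complex.exp (-((((2 * Real.pi : ℝ) : ℂ) * z) * r)) =
        (Real.exp (-(2 * Real.pi * ε * r)) : ℝ) *
          Complex.exp ((2 * Real.pi * (r * (τ - t)) : ℝ) * Complex.I) := by
      rw [Complex.ofReal_exp, ← Complex.exp_add]
      congr 1
      rw [hzdef]
      push_cast
      ring
    simp only [hf]
    rw [pow_mul_dampedSymbol s ε m hr, e]
    push_cast
    ring
  rw [setIntegral_congr_fun measurableSet_Ioi h2, integral_const_mul,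
    integral_rpow_mul_cexp_neg (by positivity) (by
      rw [Complex.re_ofReal_mul]; positivity), ofReal_mul_cpow h2pi hz0]
  have e1 : (-(2 * (s + (m : ℝ) / 2) + 1)) = -(2 * s + m + 1) := by ring
  have e2 : (((2 * Real.pi) ^ (-((m : ℝ) + 1)) : ℝ) : ℂ) = ((2 * Real.pi) ^ (2 * s) : ℝ) *
      ((2 * Real.pi : ℝ) : ℂ) ^ ((-(2 * s + m + 1) : ℝ) : ℂ) := by
    rw [← Complex.ofReal_cpow h2pi.le, ← Complex.ofReal_mul, ← Real.rpow_add h2pi]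
    congr 2
    ring
  rw [e1, kernelConst]
  push_cast at e2 ⊢
  rw [e2]
  ring

/-- The regularized kernel as a spherical mean of one-dimensional kernels. -/
lemma dampedKernel_eq (hs : 0 < s) {ε : ℝ} (hε : 0 < ε) (x : EuclideanSpace ℝ (Fin (m + 1))) :
    dampedKernel m s ε x = kernelConst m s *
      ∫ w : sphere (0 : EuclideanSpace ℝ (Fin (m + 1))) 1,
        bubblePower (s + m / 2) (-(2 * (s + m / 2) + 1))
          (ε - (inner ℝ x (w : EuclideanSpace ℝ (Fin (m + 1))) : ℝ) * Complex.I)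
        ∂(volume : Measure (EuclideanSpace ℝ (Fin (m + 1)))).toSphere := by
  rw [dampedKernel, integral_eq_integral_toSphere _ (integrable_dampedKernel_integrand hs hε x),
    ← integral_const_mul]
  congr 1
  ext w
  have hw : ‖(w : EuclideanSpace ℝ (Fin (m + 1)))‖ = 1 := by simp
  rw [← integral_radial_dampedKernel hs hε]
  refine setIntegral_congr_fun measurableSet_Ioi fun r hr => ?_
  rw [fourier_bubble_smul hs r hw, real_inner_smul_right, finrank_euclideanSpace_fin,
    Nat.add_sub_cancel]
  congr 4
  simp [dampedSymbol, norm_smul]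

end Kernel

/-! ### Limit of the kernel in the ball and value of the constant. -/

section KernelLimit

variable {m : ℕ} {s σ a : ℝ}

/-- A crude bound, valid for every `ζ` in the half-plane but degenerating at its edge; it serves
integrability at fixed `ε` only. -/
lemma norm_bubblePower_le (hσ : 0 < σ) (ha : a ≤ 0) {ζ : ℂ} (hζ : 0 < ζ.re) :
    ‖bubblePower σ a ζ‖ ≤ (∫ t : ℝ, bubble σ t) * ζ.re ^ a := by
  rw [bubblePower, ← integral_mul_const]
  refine norm_integral_le_of_norm_le ((integrable_bubble hσ).mul_const _)
    (Eventually.of_forall fun t => ?_)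
  rw [norm_mul, Complex.norm_real, Real.norm_eq_abs, abs_of_nonneg (bubble_nonneg σ t)]
  exact mul_le_mul_of_nonneg_left (norm_cpow_le_of_re ha hζ (re_add_mul_I ζ t).ge)
    (bubble_nonneg σ t)

lemma continuous_bubblePower_vertical (hσ : 0 < σ) (ha : a ≤ 0) {ε : ℝ} (hε : 0 < ε) :
    Continuous fun τ : ℝ => bubblePower σ a (ε - τ * Complex.I) := by
  refine continuous_iff_continuousAt.2 fun τ => ?_
  have h1 := (hasDerivAt_bubblePower hσ ha (ζ := ε - τ * Complex.I)
    (by rw [re_sub_mul_I]; exact hε)).continuousAt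
  exact ContinuousAt.comp (f := fun τ : ℝ => (ε : ℂ) - τ * Complex.I) h1
    (by fun_prop : Continuous fun τ : ℝ => (ε : ℂ) - τ * Complex.I).continuousAt

/-- The constant in the bound of the regularized kernel. -/
noncomputable def verticalConst (σ : ℝ) : ℝ :=
  bubbleLimit σ + (2 * σ + 1) * (∫ t : ℝ, bubble σ t) / σ

lemma verticalConst_nonneg (hσ : 0 < σ) : 0 ≤ verticalConst σ :=
  add_nonneg (bubbleLimit_nonneg hσ)
    (div_nonneg (mul_nonneg (by linarith) (integral_bubble_nonneg σ)) hσ.le)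

lemma kernelConst_nonneg (hs : 0 < s) : 0 ≤ kernelConst m s := by
  have : 0 ≤ Real.Gamma (2 * s + m + 1) := Real.Gamma_nonneg_of_nonneg (by positivity)
  exact mul_nonneg (bubbleMass_nonneg m s) (by positivity)

lemma abs_inner_le_norm_of_sphere (x : EuclideanSpace ℝ (Fin (m + 1)))
    (w : sphere (0 : EuclideanSpace ℝ (Fin (m + 1))) 1) :
    |inner ℝ x (w : EuclideanSpace ℝ (Fin (m + 1)))| ≤ ‖x‖ := by
  have := abs_real_inner_le_norm x (w : EuclideanSpace ℝ (Fin (m + 1)))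
  simpa using this

lemma norm_bubblePower_inner_le (hσ : 0 < σ) {ε : ℝ} (hε : 0 < ε)
    {x : EuclideanSpace ℝ (Fin (m + 1))} (hx : ‖x‖ < 1)
    (w : sphere (0 : EuclideanSpace ℝ (Fin (m + 1))) 1) :
    ‖bubblePower σ (-(2 * σ + 1))
      (ε - (inner ℝ x (w : EuclideanSpace ℝ (Fin (m + 1))) : ℝ) * Complex.I)‖ ≤
        verticalConst σ * (1 - ‖x‖) ^ (-σ) := by
  have h := abs_inner_le_norm_of_sphere x w
  refine (norm_bubblePower_vertical_le hσ hε (h.trans_lt hx)).trans ?_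
  exact mul_le_mul_of_nonneg_left (Real.rpow_le_rpow_of_nonpos (by linarith) (by linarith)
    (by linarith)) (verticalConst_nonneg hσ)

lemma continuous_bubblePower_inner (hσ : 0 < σ) {ε : ℝ} (hε : 0 < ε) :
    Continuous fun p : EuclideanSpace ℝ (Fin (m + 1)) ×
      sphere (0 : EuclideanSpace ℝ (Fin (m + 1))) 1 => bubblePower σ (-(2 * σ + 1))
      (ε - (inner ℝ p.1 (p.2 : EuclideanSpace ℝ (Fin (m + 1))) : ℝ) * Complex.I) :=
  (continuous_bubblePower_vertical hσ (by linarith) hε).comp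
    (g := fun τ : ℝ => bubblePower σ (-(2 * σ + 1)) (ε - τ * Complex.I))
    (f := fun p : EuclideanSpace ℝ (Fin (m + 1)) ×
      sphere (0 : EuclideanSpace ℝ (Fin (m + 1))) 1 =>
        (inner ℝ p.1 (p.2 : EuclideanSpace ℝ (Fin (m + 1))) : ℝ)) (by fun_prop)

lemma integrable_bubblePower_inner (hσ : 0 < σ) {ε : ℝ} (hε : 0 < ε)
    (x : EuclideanSpace ℝ (Fin (m + 1))) :
    Integrable (fun w : sphere (0 : EuclideanSpace ℝ (Fin (m + 1))) 1 =>
      bubblePower σ (-(2 * σ + 1))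
      (ε - (inner ℝ x (w : EuclideanSpace ℝ (Fin (m + 1))) : ℝ) * Complex.I))
      (volume : Measure (EuclideanSpace ℝ (Fin (m + 1)))).toSphere := by
  refine Integrable.of_bound ((continuous_bubblePower_inner hσ hε).comp
    (by fun_prop : Continuous fun w : sphere (0 : EuclideanSpace ℝ (Fin (m + 1))) 1 =>
      (x, w))).aestronglyMeasurable ((∫ t : ℝ, bubble σ t) * ε ^ (-(2 * σ + 1)))
    (Eventually.of_forall fun w => ?_)
  have := norm_bubblePower_le hσ (a := -(2 * σ + 1)) (by linarith)
    (ζ := ε - (inner ℝ x (w : EuclideanSpace ℝ (Fin (m + 1))) : ℝ) * Complex.I)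
    (by rw [re_sub_mul_I]; exact hε)
  rwa [re_sub_mul_I] at this

/-- The total mass of the unit sphere. -/
noncomputable def sphereMass (m : ℕ) : ℝ :=
  (volume : Measure (EuclideanSpace ℝ (Fin (m + 1)))).toSphere.real Set.univ

/-- The bound is independent of `ε` and uniform on smaller concentric balls, as required for
dominated convergence against test functions. -/
lemma norm_dampedKernel_le (hs : 0 < s) {ε : ℝ} (hε : 0 < ε)
    {x : EuclideanSpace ℝ (Fin (m + 1))} (hx : ‖x‖ < 1) :
    ‖dampedKernel m s ε x‖ ≤ kernelConst m s *
      (verticalConst (s + m / 2) * (1 - ‖x‖) ^ (-(s + m / 2)) * sphereMass m) := by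
  have hσ : 0 < s + (m : ℝ) / 2 := by positivity
  rw [dampedKernel_eq hs hε, norm_mul, Complex.norm_real, Real.norm_eq_abs,
    abs_of_nonneg (kernelConst_nonneg hs)]
  refine mul_le_mul_of_nonneg_left ?_ (kernelConst_nonneg hs)
  exact norm_integral_le_of_norm_le_const
    (Eventually.of_forall fun w => norm_bubblePower_inner_le hσ hε hx w)

/-- The value of `(-Δ)^s` on the profile `(1 - ‖x‖ ^ 2)_+ ^ s`. -/
noncomputable def torsionConst (m : ℕ) (s : ℝ) : ℝ :=
  kernelConst m s * (sphereMass m * bubbleLimit (s + m / 2))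

/-- By `conj_dampedKernel` the kernel is the spherical mean of real parts. Each has the same limit,
whatever `w` and `x`, because `|⟨x, w⟩| ≤ ‖x‖ < 1`. -/
lemma tendsto_dampedKernel (hs : 0 < s) {x : EuclideanSpace ℝ (Fin (m + 1))} (hx : ‖x‖ < 1) :
    Tendsto (fun ε : ℝ => dampedKernel m s ε x) (𝓝[>] 0) (𝓝 (torsionConst m s : ℂ)) := by
  have hσ : 0 < s + (m : ℝ) / 2 := by positivity
  have hreal : ∀ ε : ℝ, 0 < ε → dampedKernel m s ε x = ((kernelConst m s *
      ∫ w : sphere (0 : EuclideanSpace ℝ (Fin (m + 1))) 1,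
        (bubblePower (s + m / 2) (-(2 * (s + m / 2) + 1))
          (ε - (inner ℝ x (w : EuclideanSpace ℝ (Fin (m + 1))) : ℝ) * Complex.I)).re
        ∂(volume : Measure (EuclideanSpace ℝ (Fin (m + 1)))).toSphere : ℝ) : ℂ) := by
    intro ε hε
    have h1 := Complex.conj_eq_iff_re.1 (conj_dampedKernel (m := m) (s := s) ε x)
    rw [← h1, dampedKernel_eq hs hε, Complex.re_ofReal_mul]
    congr 2
    exact (integral_re (integrable_bubblePower_inner hσ hε x)).symm
  have hlim : Tendsto (fun ε : ℝ => ∫ w : sphere (0 : EuclideanSpace ℝ (Fin (m + 1))) 1,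
        (bubblePower (s + m / 2) (-(2 * (s + m / 2) + 1))
          (ε - (inner ℝ x (w : EuclideanSpace ℝ (Fin (m + 1))) : ℝ) * Complex.I)).re
        ∂(volume : Measure (EuclideanSpace ℝ (Fin (m + 1)))).toSphere) (𝓝[>] 0)
        (𝓝 (∫ _w : sphere (0 : EuclideanSpace ℝ (Fin (m + 1))) 1, bubbleLimit (s + m / 2)
          ∂(volume : Measure (EuclideanSpace ℝ (Fin (m + 1)))).toSphere)) := by
    refine tendsto_integral_filter_of_dominated_convergence
      (fun _ => verticalConst (s + m / 2) * (1 - ‖x‖) ^ (-(s + (m : ℝ) / 2))) ?_ ?_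
      (integrable_const _) ?_
    · filter_upwards [self_mem_nhdsWithin] with ε hε
      exact (integrable_bubblePower_inner hσ hε x).re.aestronglyMeasurable
    · filter_upwards [self_mem_nhdsWithin] with ε hε
      exact Eventually.of_forall fun w =>
        (Complex.abs_re_le_norm _).trans (norm_bubblePower_inner_le hσ hε hx w)
    · exact Eventually.of_forall fun w => tendsto_re_bubblePower hσ
        ((abs_inner_le_norm_of_sphere x w).trans_lt hx)
  rw [integral_const, smul_eq_mul] at hlim
  have h2 := (Complex.continuous_ofReal.tendsto _).comp (hlim.const_mul (kernelConst m s))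
  refine h2.congr' ?_
  filter_upwards [self_mem_nhdsWithin] with ε hε
  exact (hreal ε hε).symm

/-- After inserting the Gamma formulas for the masses and the area of the sphere, the identity
reduces to Legendre's duplication formula at `σ + 1`. -/
lemma torsionConst_eq (hs : 0 < s) :
    torsionConst m s = 2 ^ (2 * s) * Real.Gamma (1 + s) *
      Real.Gamma (((m + 1 : ℕ) + 2 * s) / 2) / Real.Gamma ((m + 1 : ℕ) / 2) := by
  have hm : (0 : ℝ) ≤ m := by positivity
  obtain ⟨σ, hσdef⟩ : ∃ σ : ℝ, σ = s + m / 2 := ⟨_, rfl⟩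
  have hσ : 0 < σ := by rw [hσdef]; positivity
  have hS : sphereMass m = 2 * Real.sqrt Real.pi ^ (m + 1) / Real.Gamma ((m + 1 : ℕ) / 2) := by
    have h1 : Real.Gamma (((m + 1 : ℕ) : ℝ) / 2 + 1) =
        ((m + 1 : ℕ) : ℝ) / 2 * Real.Gamma ((m + 1 : ℕ) / 2) :=
      Real.Gamma_add_one (by positivity)
    have h2 : 0 < Real.Gamma (((m + 1 : ℕ) : ℝ) / 2) := Real.Gamma_pos_of_pos (by positivity)
    rw [sphereMass, Measure.toSphere_real_apply_univ, measureReal_def, EuclideanSpace.volume_ball,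
      finrank_euclideanSpace_fin, Fintype.card_fin, ENNReal.ofReal_one, one_pow, one_mul,
      ENNReal.toReal_ofReal (by rw [h1]; positivity), h1]
    field_simp
  have hdup := Real.Gamma_mul_Gamma_add_half (σ + 1)
  have e1 : σ + 1 + 1 / 2 = σ + 3 / 2 := by ring
  have e2 : 2 * (σ + 1) = (2 * σ + 1) + 1 := by ring
  have e3 : 1 - ((2 * σ + 1) + 1) = -(2 * σ + 1) := by ring
  rw [e1, e2, e3, Real.Gamma_add_one (s := 2 * σ + 1) (by linarith)] at hdup
  have g1 : 0 < Real.Gamma (σ + 1) := Real.Gamma_pos_of_pos (by linarith)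
  have g2 : 0 < Real.Gamma (σ + 3 / 2) := Real.Gamma_pos_of_pos (by linarith)
  have g3 : 0 < Real.Gamma (2 * σ + 1) := Real.Gamma_pos_of_pos (by linarith)
  have g4 : 0 < Real.Gamma (((m + 1 : ℕ) : ℝ) / 2) := Real.Gamma_pos_of_pos (by positivity)
  rw [torsionConst, ← hσdef, kernelConst, bubbleMass_eq hs, bubbleLimit, integral_bubble_real hσ,
    integral_Ioi_one_add_sq_rpow (by linarith), hS]
  have e4 : s + 1 + (m : ℝ) / 2 = σ + 1 := by rw [hσdef]; ring
  have e5 : 2 * s + m + 1 = 2 * σ + 1 := by rw [hσdef]; ring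
  have e6 : σ + 1 - 1 / 2 = σ + 1 / 2 := by ring
  have e7 : (((m + 1 : ℕ) : ℝ) + 2 * s) / 2 = σ + 1 / 2 := by rw [hσdef]; push_cast; ring
  rw [e4, e5, e6, e7, add_comm s 1]
  have hsq : Real.sqrt Real.pi ^ 2 = Real.pi := Real.sq_sqrt Real.pi_pos.le
  have hp0 : 0 < Real.sqrt Real.pi := Real.sqrt_pos.2 Real.pi_pos
  have hpow : (2 * Real.pi) ^ (-((m : ℝ) + 1)) = (2 : ℝ) ^ (-((m : ℝ) + 1)) *
      (Real.sqrt Real.pi ^ (m + 1) * Real.sqrt Real.pi ^ (m + 1))⁻¹ := by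
    rw [Real.mul_rpow (by norm_num) Real.pi_pos.le, ← mul_pow, ← pow_two, hsq,
      Real.rpow_neg Real.pi_pos.le]
    norm_cast
  have h2 : (2 : ℝ) ^ (2 * s) = 2 ^ (-((m : ℝ) + 1)) * 2 ^ (2 * σ + 1) := by
    rw [← Real.rpow_add two_pos]
    congr 1
    rw [hσdef]
    ring
  have h3 : (2 : ℝ) ^ (-(2 * σ + 1)) * 2 ^ (2 * σ + 1) = 1 := by
    rw [← Real.rpow_add two_pos]
    simp
  have h4 : (0 : ℝ) < 2 ^ (2 * σ + 1) := by positivity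
  have hdup' : Real.Gamma (2 * σ + 1) * (2 * σ + 1) * Real.sqrt Real.pi =
      Real.Gamma (σ + 1) * Real.Gamma (σ + 3 / 2) * 2 ^ (2 * σ + 1) := by
    rw [hdup]
    linear_combination (-(2 * σ + 1) * Real.Gamma (2 * σ + 1) * Real.sqrt Real.pi) * h3
  rw [hpow, h2]
  generalize Real.Gamma (σ + 1) = G1 at *
  generalize Real.Gamma (σ + 3 / 2) = G2 at *
  generalize Real.Gamma (2 * σ + 1) = G3 at *
  generalize Real.Gamma (((m + 1 : ℕ) : ℝ) / 2) = G4 at *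
  generalize Real.Gamma (σ + 1 / 2) = G5 at *
  generalize (2 : ℝ) ^ (2 * σ + 1) = P at *
  field_simp
  rw [pow_succ]
  linear_combination (Real.sqrt Real.pi ^ m * Real.sqrt Real.pi * G5) * hdup'

end KernelLimit

/-! ### Finite energy and the weak equation for the profile. -/

section Pairing

variable {m : ℕ} {s : ℝ}

/-- Damping makes the double integral absolutely convergent for every integrable `f`. It is used
with `f` a test function, for the equation, and with `f` the profile itself, for the energy. -/
lemma integral_dampedSymbol_mul_fourier (hs : 0 < s) {ε : ℝ} (hε : 0 < ε)
    {f : EuclideanSpace ℝ (Fin (m + 1)) → ℝ} (hf : Integrable f) :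
    ∫ ξ : EuclideanSpace ℝ (Fin (m + 1)), (dampedSymbol s ε ξ : ℂ) *
      𝓕 (fun x : EuclideanSpace ℝ (Fin (m + 1)) => (bubble s x : ℂ)) ξ *
        conj (𝓕 (fun x => (f x : ℂ)) ξ) = ∫ x, (f x : ℂ) * dampedKernel m s ε x := by
  set g : EuclideanSpace ℝ (Fin (m + 1)) → ℂ := fun ξ => (dampedSymbol s ε ξ : ℂ) *
      𝓕 (fun x : EuclideanSpace ℝ (Fin (m + 1)) => (bubble s x : ℂ)) ξ with hg
  have hgint : Integrable g := integrable_dampedSymbol_mul_fourier hs hε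
  set H : EuclideanSpace ℝ (Fin (m + 1)) → EuclideanSpace ℝ (Fin (m + 1)) → ℂ := fun ξ x =>
    g ξ * (f x : ℂ) * Complex.exp ((2 * Real.pi * inner ℝ x ξ : ℝ) * Complex.I) with hH
  have hint : Integrable (Function.uncurry H) (volume.prod volume) := by
    exact (Integrable.mul_prod (f := g)
      (g := fun x : EuclideanSpace ℝ (Fin (m + 1)) => (f x : ℂ)) hgint hf.ofReal).mul_bdd (c := 1)
      (by fun_prop : Continuous
        fun z : EuclideanSpace ℝ (Fin (m + 1)) × EuclideanSpace ℝ (Fin (m + 1)) =>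
        Complex.exp ((2 * Real.pi * inner ℝ z.2 z.1 : ℝ) * Complex.I)).aestronglyMeasurable
      (Eventually.of_forall fun z => by rw [Complex.norm_exp_ofReal_mul_I])
  have h1 : ∀ ξ, g ξ * conj (𝓕 (fun x => (f x : ℂ)) ξ) = ∫ x, H ξ x := by
    intro ξ
    rw [conj_fourier_ofReal, ← integral_const_mul]
    congr 1
    ext x
    rw [Complex.real_smul]
    simp only [hH]
    ring
  refine (integral_congr_ae (Eventually.of_forall h1)).trans ?_
  rw [integral_integral_swap hint]
  congr 1
  ext x
  rw [dampedKernel, ← integral_const_mul]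
  congr 1
  ext ξ
  simp only [hH, hg]
  ring

/-- Since `1 - t ^ 2 = (1 - |t|)(1 + |t|)`, the vanishing of the marginal compensates the possible
blow-up of the one-dimensional kernel at `±1`. -/
lemma bubble_mul_le {σ : ℝ} (hσ : 0 < σ) {t : ℝ} (ht : |t| < 1) :
    bubble σ t * (1 - |t|) ^ (-σ) ≤ 2 ^ σ := by
  have h0 : 0 < 1 - |t| := by linarith
  have e : bubble σ t = (1 - |t|) ^ σ * (1 + |t|) ^ σ := by
    rw [bubble_of_norm_le_one σ (by simpa using ht.le), Real.norm_eq_abs,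
      ← Real.mul_rpow h0.le (by positivity)]
    congr 1
    ring
  rw [e, mul_right_comm, ← Real.rpow_add h0, add_neg_cancel, Real.rpow_zero, one_mul]
  exact Real.rpow_le_rpow (by positivity) (by linarith) hσ.le

lemma norm_integral_bubble_mul_bubblePower_le {σ : ℝ} (hσ : 0 < σ) {ε : ℝ} (hε : 0 < ε) :
    ‖∫ t : ℝ, bubble σ t • bubblePower σ (-(2 * σ + 1)) (ε - t * Complex.I)‖ ≤
      2 * (verticalConst σ * 2 ^ σ) := by
  have hint : Integrable ((Set.Ioo (-1 : ℝ) 1).indicator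
      fun _ => verticalConst σ * (2 : ℝ) ^ σ) :=
    (integrable_indicator_iff measurableSet_Ioo).2 (integrableOn_const (by simp))
  refine (norm_integral_le_of_norm_le hint (Eventually.of_forall fun t => ?_)).trans
    (le_of_eq ?_)
  · by_cases ht : |t| < 1
    · rw [Set.indicator_of_mem (Set.mem_Ioo.2 (abs_lt.1 ht)), norm_smul, Real.norm_eq_abs,
        abs_of_nonneg (bubble_nonneg σ t)]
      calc _ ≤ bubble σ t * (verticalConst σ * (1 - |t|) ^ (-σ)) :=
            mul_le_mul_of_nonneg_left (norm_bubblePower_vertical_le hσ hε ht)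
              (bubble_nonneg σ t)
        _ = verticalConst σ * (bubble σ t * (1 - |t|) ^ (-σ)) := by ring
        _ ≤ _ := mul_le_mul_of_nonneg_left (bubble_mul_le hσ ht) (verticalConst_nonneg hσ)
    · rw [Set.indicator_of_notMem (fun h => ht (abs_lt.2 (Set.mem_Ioo.1 h))),
        bubble_of_one_le hσ (by simpa using ht)]
      simp
  · rw [integral_indicator measurableSet_Ioo, setIntegral_const]
    simp
    norm_num

/-- Pair the profile with its own regularized kernel. For each direction `w` the marginal formula
applies a second time and leaves a one-dimensional integral bounded independently of `ε`. -/
lemma integral_dampedSymbol_mul_sq_le (hs : 0 < s) {ε : ℝ} (hε : 0 < ε) :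
    ∫ ξ : EuclideanSpace ℝ (Fin (m + 1)), dampedSymbol s ε ξ *
      ‖𝓕 (fun x : EuclideanSpace ℝ (Fin (m + 1)) => (bubble s x : ℂ)) ξ‖ ^ 2 ≤
    kernelConst m s * (sphereMass m * (bubbleMass m s *
      (2 * (verticalConst (s + m / 2) * 2 ^ (s + (m : ℝ) / 2))))) := by
  have hσ : 0 < s + (m : ℝ) / 2 := by positivity
  set U : EuclideanSpace ℝ (Fin (m + 1)) → ℂ :=
    𝓕 (fun x : EuclideanSpace ℝ (Fin (m + 1)) => (bubble s x : ℂ)) with hU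
  set Q : EuclideanSpace ℝ (Fin (m + 1)) → sphere (0 : EuclideanSpace ℝ (Fin (m + 1))) 1 → ℂ :=
    fun x w => bubblePower (s + m / 2) (-(2 * (s + m / 2) + 1))
      (ε - (inner ℝ x (w : EuclideanSpace ℝ (Fin (m + 1))) : ℝ) * Complex.I) with hQ
  have h1 : ((∫ ξ, dampedSymbol s ε ξ * ‖U ξ‖ ^ 2 : ℝ) : ℂ) =
      ∫ x : EuclideanSpace ℝ (Fin (m + 1)), (bubble s x : ℂ) * dampedKernel m s ε x := by
    rw [← integral_dampedSymbol_mul_fourier hs hε (integrable_bubble hs), ← integral_complex_ofReal]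
    congr 1
    ext ξ
    rw [mul_assoc, Complex.mul_conj, Complex.normSq_eq_norm_sq]
    push_cast
    rfl
  have h2 : ∀ x : EuclideanSpace ℝ (Fin (m + 1)), (bubble s x : ℂ) * dampedKernel m s ε x =
      kernelConst m s * ∫ w, bubble s x • Q x w
        ∂(volume : Measure (EuclideanSpace ℝ (Fin (m + 1)))).toSphere := by
    intro x
    rw [dampedKernel_eq hs hε, integral_smul, Complex.real_smul]
    ring
  have hint : Integrable (Function.uncurry fun x w => bubble s x • Q x w)
      ((volume : Measure (EuclideanSpace ℝ (Fin (m + 1)))).prod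
        (volume : Measure (EuclideanSpace ℝ (Fin (m + 1)))).toSphere) := by
    have hb : Integrable (fun z : EuclideanSpace ℝ (Fin (m + 1)) ×
        sphere (0 : EuclideanSpace ℝ (Fin (m + 1))) 1 => (bubble s z.1 : ℂ) * 1)
        ((volume : Measure (EuclideanSpace ℝ (Fin (m + 1)))).prod
        (volume : Measure (EuclideanSpace ℝ (Fin (m + 1)))).toSphere) :=
      Integrable.mul_prod (f := fun x : EuclideanSpace ℝ (Fin (m + 1)) => (bubble s x : ℂ))
        (g := fun _ => (1 : ℂ)) (integrable_bubble hs).ofReal (integrable_const _)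
    have := hb.mul_bdd (c := (∫ t : ℝ, bubble (s + m / 2) t) * ε ^ (-(2 * (s + (m : ℝ) / 2) + 1)))
      (continuous_bubblePower_inner hσ hε).aestronglyMeasurable
      (Eventually.of_forall fun z => by
        have := norm_bubblePower_le hσ (a := -(2 * (s + m / 2) + 1)) (by linarith)
          (ζ := ε - (inner ℝ z.1 (z.2 : EuclideanSpace ℝ (Fin (m + 1))) : ℝ) * Complex.I)
          (by rw [re_sub_mul_I]; exact hε)
        rwa [re_sub_mul_I] at this)
    refine this.congr (Eventually.of_forall fun z => ?_)
    simp only [Function.uncurry, hQ, Complex.real_smul, mul_one]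
  have h3 : ∀ w : sphere (0 : EuclideanSpace ℝ (Fin (m + 1))) 1,
      ‖∫ x, bubble s x • Q x w‖ ≤ bubbleMass m s *
      (2 * (verticalConst (s + m / 2) * 2 ^ (s + (m : ℝ) / 2))) := by
    intro w
    have hw : ‖(w : EuclideanSpace ℝ (Fin (m + 1)))‖ = 1 := by simp
    have := integral_bubble_smul_inner hs
      (continuous_bubblePower_vertical hσ (a := -(2 * (s + m / 2) + 1)) (by linarith) hε) hw
    have e : ∫ x, bubble s x • Q x w = bubbleMass m s • ∫ t : ℝ, bubble (s + m / 2) t •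
        bubblePower (s + m / 2) (-(2 * (s + m / 2) + 1)) (ε - t * Complex.I) := by
      rw [← this]
      congr 1
      ext x
      rw [real_inner_comm]
    rw [e, norm_smul, Real.norm_eq_abs, abs_of_nonneg (bubbleMass_nonneg m s)]
    exact mul_le_mul_of_nonneg_left (norm_integral_bubble_mul_bubblePower_le hσ hε)
      (bubbleMass_nonneg m s)
  refine (le_abs_self _).trans ?_
  rw [← Real.norm_eq_abs, ← Complex.norm_real, h1]
  simp_rw [h2]
  rw [integral_const_mul, integral_integral_swap hint, norm_mul, Complex.norm_real,
    Real.norm_eq_abs, abs_of_nonneg (kernelConst_nonneg hs)]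
  refine mul_le_mul_of_nonneg_left ?_ (kernelConst_nonneg hs)
  rw [mul_comm]
  exact norm_integral_le_of_norm_le_const (Eventually.of_forall h3)

/-- The energy of the profile `(1 - ‖x‖ ^ 2)_+ ^ s` is finite. -/
lemma integrable_rpow_mul_fourier_bubble_sq (hs : 0 < s) :
    Integrable fun ξ : EuclideanSpace ℝ (Fin (m + 1)) => (2 * Real.pi * ‖ξ‖) ^ (2 * s) *
      ‖𝓕 (fun x : EuclideanSpace ℝ (Fin (m + 1)) => (bubble s x : ℂ)) ξ‖ ^ 2 := by
  set U : EuclideanSpace ℝ (Fin (m + 1)) → ℂ :=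
    𝓕 (fun x : EuclideanSpace ℝ (Fin (m + 1)) => (bubble s x : ℂ)) with hU
  have hUc : Continuous U := continuous_fourier_bubble hs
  set K := kernelConst m s * (sphereMass m * (bubbleMass m s *
      (2 * (verticalConst (s + m / 2) * 2 ^ (s + (m : ℝ) / 2))))) with hK
  have hcont : Continuous fun ξ : EuclideanSpace ℝ (Fin (m + 1)) =>
      (2 * Real.pi * ‖ξ‖) ^ (2 * s) * ‖U ξ‖ ^ 2 := by
    refine Continuous.mul ?_ (by fun_prop)
    exact (by fun_prop : Continuous fun ξ : EuclideanSpace ℝ (Fin (m + 1)) =>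
      2 * Real.pi * ‖ξ‖).rpow_const fun _ => Or.inr (by linarith)
  refine ⟨hcont.aestronglyMeasurable, ?_⟩
  rw [hasFiniteIntegral_iff_ofReal (Eventually.of_forall fun ξ => by
    simp only [Pi.zero_apply]; positivity)]
  -- Fatou's lemma along `ε = 1 / (k + 1)` carries the uniform bound over to the undamped energy.
  have hlim : ∀ ξ : EuclideanSpace ℝ (Fin (m + 1)), Tendsto (fun k : ℕ =>
      ENNReal.ofReal (dampedSymbol s (1 / ((k : ℝ) + 1)) ξ * ‖U ξ‖ ^ 2)) atTop
      (𝓝 (ENNReal.ofReal ((2 * Real.pi * ‖ξ‖) ^ (2 * s) * ‖U ξ‖ ^ 2))) := by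
    intro ξ
    refine (ENNReal.continuous_ofReal.tendsto _).comp ?_
    have h1 : Continuous fun ε : ℝ => dampedSymbol s ε ξ * ‖U ξ‖ ^ 2 := by
      unfold dampedSymbol
      fun_prop
    have h2 := (h1.tendsto 0).comp (tendsto_one_div_add_atTop_nhds_zero_nat (𝕜 := ℝ))
    simpa [dampedSymbol, Function.comp_def] using h2
  have hle : ∀ k : ℕ, ∫⁻ ξ, ENNReal.ofReal (dampedSymbol s (1 / ((k : ℝ) + 1)) ξ * ‖U ξ‖ ^ 2) ≤
      ENNReal.ofReal K := by
    intro k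
    have hε : (0 : ℝ) < 1 / ((k : ℝ) + 1) := by positivity
    rw [← ofReal_integral_eq_lintegral_ofReal]
    · exact ENNReal.ofReal_le_ofReal (integral_dampedSymbol_mul_sq_le hs hε)
    · refine (integrable_dampedSymbol hs hε).mul_bdd (c := bubbleMass (m + 1) s ^ 2)
        (by fun_prop : Continuous fun ξ => ‖U ξ‖ ^ 2).aestronglyMeasurable
        (Eventually.of_forall fun ξ => ?_)
      rw [Real.norm_eq_abs, abs_of_nonneg (by positivity)]
      exact pow_le_pow_left₀ (norm_nonneg _) (norm_fourier_bubble_le s ξ) 2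
    · exact Eventually.of_forall fun ξ => mul_nonneg (dampedSymbol_nonneg s _ ξ) (by positivity)
  calc ∫⁻ ξ, ENNReal.ofReal ((2 * Real.pi * ‖ξ‖) ^ (2 * s) * ‖U ξ‖ ^ 2)
      = ∫⁻ ξ, liminf (fun k : ℕ =>
        ENNReal.ofReal (dampedSymbol s (1 / ((k : ℝ) + 1)) ξ * ‖U ξ‖ ^ 2)) atTop :=
        lintegral_congr fun ξ => (hlim ξ).liminf_eq.symm
    _ ≤ liminf (fun k : ℕ => ∫⁻ ξ,
        ENNReal.ofReal (dampedSymbol s (1 / ((k : ℝ) + 1)) ξ * ‖U ξ‖ ^ 2)) atTop := by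
        refine lintegral_liminf_le fun k => ?_
        exact (ENNReal.continuous_ofReal.comp ((continuous_dampedSymbol hs _).mul
          (by fun_prop))).measurable
    _ ≤ ENNReal.ofReal K := by
        refine (liminf_le_liminf (Eventually.of_forall hle)).trans ?_
        simp
    _ < ⊤ := ENNReal.ofReal_lt_top

lemma dampedSymbol_le {E : Type*} [NormedAddCommGroup E] (s : ℝ) {ε : ℝ} (hε : 0 ≤ ε) (ξ : E) :
    dampedSymbol s ε ξ ≤ (2 * Real.pi * ‖ξ‖) ^ (2 * s) := by
  refine mul_le_of_le_one_right (by positivity) (Real.exp_le_one_iff.2 ?_)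
  have : 0 ≤ 2 * Real.pi * ‖ξ‖ * ε := by positivity
  linarith

/-- The equation `(-Δ)^s (1 - ‖x‖ ^ 2)_+ ^ s = const` in the unit ball, tested against `f`. -/
lemma integral_rpow_mul_fourier_bubble_mul (hs : 0 < s)
    {f : EuclideanSpace ℝ (Fin (m + 1)) → ℝ} (hf : Continuous f) (hfc : HasCompactSupport f)
    (hfs : tsupport f ⊆ ball 0 1)
    (hint : Integrable fun ξ : EuclideanSpace ℝ (Fin (m + 1)) =>
      (((2 * Real.pi * ‖ξ‖) ^ (2 * s) : ℝ) : ℂ) *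
      𝓕 (fun x : EuclideanSpace ℝ (Fin (m + 1)) => (bubble s x : ℂ)) ξ *
        conj (𝓕 (fun x => (f x : ℂ)) ξ)) :
    ∫ ξ : EuclideanSpace ℝ (Fin (m + 1)), (((2 * Real.pi * ‖ξ‖) ^ (2 * s) : ℝ) : ℂ) *
      𝓕 (fun x : EuclideanSpace ℝ (Fin (m + 1)) => (bubble s x : ℂ)) ξ *
        conj (𝓕 (fun x => (f x : ℂ)) ξ) = ((torsionConst m s * ∫ x, f x : ℝ) : ℂ) := by
  have hσ : 0 < s + (m : ℝ) / 2 := by positivity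
  have hfi : Integrable f := hf.integrable_of_hasCompactSupport hfc
  set U : EuclideanSpace ℝ (Fin (m + 1)) → ℂ :=
    𝓕 (fun x : EuclideanSpace ℝ (Fin (m + 1)) => (bubble s x : ℂ)) with hU
  set V : EuclideanSpace ℝ (Fin (m + 1)) → ℂ :=
    𝓕 (fun x : EuclideanSpace ℝ (Fin (m + 1)) => (f x : ℂ)) with hV
  have hUc : Continuous U := continuous_fourier_bubble hs
  have hVc : Continuous V := VectorFourier.fourierIntegral_continuous Real.continuous_fourierChar
    continuous_inner hfi.ofReal
  -- The support of `f` stays in a ball of radius `r < 1`, on which the kernel is bounded uniformly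
  -- in `ε`.
  obtain ⟨r, hr, hsub⟩ := exists_pos_lt_subset_ball one_pos (isClosed_tsupport f) hfs
  have h1 : Tendsto (fun ε : ℝ => ∫ ξ : EuclideanSpace ℝ (Fin (m + 1)),
      (dampedSymbol s ε ξ : ℂ) * U ξ * conj (V ξ)) (𝓝[>] 0)
      (𝓝 (∫ ξ : EuclideanSpace ℝ (Fin (m + 1)), (((2 * Real.pi * ‖ξ‖) ^ (2 * s) : ℝ) : ℂ) *
        U ξ * conj (V ξ))) := by
    refine tendsto_integral_filter_of_dominated_convergence _ ?_ ?_ hint.norm ?_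
    · refine Eventually.of_forall fun ε => Continuous.aestronglyMeasurable ?_
      exact ((Complex.continuous_ofReal.comp (continuous_dampedSymbol hs ε)).mul hUc).mul
        (Complex.continuous_conj.comp hVc)
    · filter_upwards [self_mem_nhdsWithin] with ε hε
      refine Eventually.of_forall fun ξ => ?_
      simp only [norm_mul, Complex.norm_real, Real.norm_eq_abs]
      rw [abs_of_nonneg (dampedSymbol_nonneg s ε ξ),
        abs_of_nonneg (by positivity : (0 : ℝ) ≤ (2 * Real.pi * ‖ξ‖) ^ (2 * s))]
      gcongr
      exact dampedSymbol_le s (le_of_lt hε) ξ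
    · refine Eventually.of_forall fun ξ => ?_
      have h1 : Continuous fun ε : ℝ => (dampedSymbol s ε ξ : ℂ) * U ξ * conj (V ξ) := by
        unfold dampedSymbol
        fun_prop
      have h2 := (h1.tendsto 0).mono_left (nhdsWithin_le_nhds (s := Set.Ioi 0))
      simpa [dampedSymbol] using h2
  have h2 : Tendsto (fun ε : ℝ => ∫ x, (f x : ℂ) * dampedKernel m s ε x) (𝓝[>] 0)
      (𝓝 (∫ x, (f x : ℂ) * (torsionConst m s : ℂ))) := by
    refine tendsto_integral_filter_of_dominated_convergence
      (fun x => |f x| * (kernelConst m s *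
        (verticalConst (s + m / 2) * (1 - r) ^ (-(s + (m : ℝ) / 2)) * sphereMass m))) ?_ ?_
      (hfi.abs.mul_const _) ?_
    · filter_upwards [self_mem_nhdsWithin] with ε hε
      refine hfi.ofReal.aestronglyMeasurable.mul (Continuous.aestronglyMeasurable ?_)
      refine continuous_of_dominated
        (bound := fun ξ => ‖(dampedSymbol s ε ξ : ℂ) * U ξ‖)
        (fun x => (integrable_dampedKernel_integrand hs hε x).aestronglyMeasurable)
        (fun x => Eventually.of_forall fun ξ => ?_)
        (integrable_dampedSymbol_mul_fourier hs hε).norm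
        (Eventually.of_forall fun ξ => by fun_prop)
      rw [norm_mul, Complex.norm_exp_ofReal_mul_I, mul_one]
    · filter_upwards [self_mem_nhdsWithin] with ε hε
      refine Eventually.of_forall fun x => ?_
      rw [norm_mul, Complex.norm_real, Real.norm_eq_abs]
      by_cases hx : f x = 0
      · simp [hx]
      · have hxr : ‖x‖ < r := by simpa using hsub (subset_tsupport f hx)
        refine mul_le_mul_of_nonneg_left ((norm_dampedKernel_le hs hε
          (hxr.trans hr.2)).trans ?_) (abs_nonneg _)
        refine mul_le_mul_of_nonneg_left ?_ (kernelConst_nonneg hs)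
        refine mul_le_mul_of_nonneg_right ?_ measureReal_nonneg
        refine mul_le_mul_of_nonneg_left ?_ (verticalConst_nonneg hσ)
        exact Real.rpow_le_rpow_of_nonpos (by linarith [hr.2]) (by linarith) (by linarith)
    · refine Eventually.of_forall fun x => ?_
      by_cases hx : f x = 0
      · simp [hx]
      · have hxr : ‖x‖ < r := by simpa using hsub (subset_tsupport f hx)
        exact (tendsto_dampedKernel hs (hxr.trans hr.2)).const_mul _
  have h3 : Tendsto (fun ε : ℝ => ∫ ξ : EuclideanSpace ℝ (Fin (m + 1)),
      (dampedSymbol s ε ξ : ℂ) * U ξ * conj (V ξ)) (𝓝[>] 0)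
      (𝓝 (∫ x, (f x : ℂ) * (torsionConst m s : ℂ))) := by
    refine h2.congr' ?_
    filter_upwards [self_mem_nhdsWithin] with ε hε
    exact (integral_dampedSymbol_mul_fourier hs hε hfi).symm
  rw [tendsto_nhds_unique h1 h3, integral_mul_const, integral_complex_ofReal]
  push_cast
  ring

end Pairing

/-! ### Comparison of the homogeneous and inhomogeneous weights. -/

section Symbol

variable {E : Type*} [NormedAddCommGroup E] {s : ℝ}

/-- With `one_add_norm_sq_rpow_le` this translates between the weight of the Sobolev space and the
weight of the pairing. -/
lemma two_pi_norm_rpow_le (hs : 0 ≤ s) (ξ : E) :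
    (2 * Real.pi * ‖ξ‖) ^ s ≤ (2 * Real.pi) ^ s * (1 + ‖ξ‖ ^ 2) ^ (s / 2) := by
  rw [Real.mul_rpow (by positivity) (norm_nonneg _)]
  gcongr
  have : ‖ξ‖ ^ s = (‖ξ‖ ^ 2) ^ (s / 2) := by
    rw [← Real.rpow_natCast, ← Real.rpow_mul (norm_nonneg _)]
    congr 1
    push_cast
    ring
  rw [this]
  exact Real.rpow_le_rpow (by positivity) (by linarith) (by linarith)

lemma one_add_norm_sq_rpow_le (hs : 0 ≤ s) (ξ : E) :
    (1 + ‖ξ‖ ^ 2) ^ (s / 2) ≤ 2 ^ (s / 2) * (1 + (2 * Real.pi * ‖ξ‖) ^ s) := by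
  have hpi : 1 ≤ 2 * Real.pi := by linarith [Real.pi_gt_three]
  have h0 := norm_nonneg ξ
  rcases le_total ‖ξ‖ 1 with h | h
  · have h1 : (1 + ‖ξ‖ ^ 2) ^ (s / 2) ≤ 2 ^ (s / 2) :=
      Real.rpow_le_rpow (by positivity) (by nlinarith) (by linarith)
    have h2 : 0 ≤ (2 * Real.pi * ‖ξ‖) ^ s := by positivity
    have h3 : (0 : ℝ) ≤ 2 ^ (s / 2) := by positivity
    nlinarith
  · have h1 : (1 + ‖ξ‖ ^ 2) ^ (s / 2) ≤ (2 * (2 * Real.pi * ‖ξ‖) ^ 2) ^ (s / 2) := by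
      refine Real.rpow_le_rpow (by positivity) ?_ (by linarith)
      have : ‖ξ‖ ≤ 2 * Real.pi * ‖ξ‖ := by nlinarith
      nlinarith
    have h2 : (2 * (2 * Real.pi * ‖ξ‖) ^ 2) ^ (s / 2) =
        2 ^ (s / 2) * (2 * Real.pi * ‖ξ‖) ^ s := by
      rw [Real.mul_rpow (by norm_num) (by positivity), ← Real.rpow_natCast (2 * Real.pi * ‖ξ‖),
        ← Real.rpow_mul (by positivity)]
      congr 2
      push_cast
      ring
    have h3 : (0 : ℝ) ≤ 2 ^ (s / 2) := by positivity
    nlinarith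

lemma continuous_two_pi_norm_rpow (hs : 0 ≤ s) :
    Continuous fun ξ : E => (2 * Real.pi * ‖ξ‖) ^ s :=
  (by fun_prop : Continuous fun ξ : E => 2 * Real.pi * ‖ξ‖).rpow_const fun _ => Or.inr hs

/-- A real test function as a complex Schwartz function. -/
noncomputable def schwartzOfReal [NormedSpace ℝ E] {g : E → ℝ} (hg : ContDiff ℝ ∞ g)
    (hc : HasCompactSupport g) :
    𝓢(E, ℂ) :=
  have h1 : HasCompactSupport (Complex.ofRealCLM ∘ g) := hc.comp_left rfl
  have h2 : ContDiff ℝ ∞ (Complex.ofRealCLM ∘ g) := by fun_prop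
  h1.toSchwartzMap h2

lemma schwartzOfReal_apply [NormedSpace ℝ E] {g : E → ℝ} (hg : ContDiff ℝ ∞ g)
    (hc : HasCompactSupport g) (x : E) :
    schwartzOfReal hg hc x = (g x : ℂ) := rfl

end Symbol

/-! ### From the distributional definitions to Fourier integrals. -/

section Bridge

variable {E : Type*} [NormedAddCommGroup E] [InnerProductSpace ℝ E] [FiniteDimensional ℝ E]
  [MeasurableSpace E] [BorelSpace E] {s : ℝ}

lemma continuous_fourier {f : E → ℂ} (hf : Integrable f) : Continuous (𝓕 f) :=
  VectorFourier.fourierIntegral_continuous Real.continuous_fourierChar continuous_inner hf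

lemma fourier_congr_ae {f g : E → ℂ} (h : f =ᵐ[volume] g) : 𝓕 f = 𝓕 g := by
  ext ξ
  rw [Real.fourier_eq, Real.fourier_eq]
  refine integral_congr_ae ?_
  filter_upwards [h] with x hx
  rw [hx]

lemma fourier_sub_apply {f g : E → ℂ} (hf : Integrable f) (hg : Integrable g) (ξ : E) :
    𝓕 (fun x => f x - g x) ξ = 𝓕 f ξ - 𝓕 g ξ := by
  simp only [Real.fourier_eq]
  rw [← integral_sub]
  · congr 1
    ext x
    rw [smul_sub]
  · exact (Real.fourierIntegral_convergent_iff ξ).2 hf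
  · exact (Real.fourierIntegral_convergent_iff ξ).2 hg

/-- Two locally integrable functions inducing the same tempered distribution agree a.e. -/
lemma ae_eq_of_integral_schwartz_smul_eq {f g : E → ℂ} (hf : LocallyIntegrable f)
    (hg : LocallyIntegrable g) (h : ∀ φ : 𝓢(E, ℂ), ∫ x, φ x • f x = ∫ x, φ x • g x) :
    f =ᵐ[volume] g := by
  refine ae_eq_of_integral_contDiff_smul_eq hf hg fun φ hφ hc => ?_
  have := h (schwartzOfReal hφ hc)
  simpa [schwartzOfReal_apply] using this

/-- The Fourier transform on `L²` agrees with the Fourier integral on `L¹ ∩ L²`. -/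
lemma fourier_toLp_ae_eq {f : E → ℂ} (hf : Integrable f) (hf2 : MemLp f 2 volume) :
    (𝓕 (hf2.toLp f) : Lp ℂ 2 (volume : Measure E)) =ᵐ[volume] 𝓕 f := by
  refine ae_eq_of_integral_schwartz_smul_eq ((Lp.memLp _).locallyIntegrable (by norm_num))
    (continuous_fourier hf).locallyIntegrable fun φ => ?_
  have h1 := congrArg (fun T : 𝓢'(E, ℂ) => T φ)
    (Lp.fourier_toTemperedDistribution_eq (hf2.toLp f))
  simp only [TemperedDistribution.fourier_apply, Lp.toTemperedDistribution_apply] at h1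
  rw [← h1]
  -- The multiplication formula for the Fourier integral; the distributional transform on `L²`
  -- satisfies the same formula by definition, so both induce the same distribution.
  have h2 : ∫ x, (𝓕 φ) x • f x = ∫ x, φ x • 𝓕 f x := by
    simpa using! VectorFourier.integral_fourierIntegral_smul_eq_flip (L := innerₗ E)
      Real.continuous_fourierChar continuous_inner φ.integrable hf
  rw [← h2]
  refine integral_congr_ae ?_
  filter_upwards [hf2.coeFn_toLp] with x hx
  rw [hx]

/-- For integrable `f` the transform is a continuous function, so the Bessel multiplier acts
pointwise and the `L²` function required by the Sobolev condition can only be this product. -/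
lemma memSobolev_two_iff_memLp {f : E → ℂ} (hf : Integrable f) (hf2 : MemLp f 2 volume) :
    TemperedDistribution.MemSobolev s 2 (hf2.toLp f : 𝓢'(E, ℂ)) ↔
      MemLp (fun ξ : E => (((1 + ‖ξ‖ ^ 2) ^ (s / 2) : ℝ) : ℂ) * 𝓕 f ξ) 2 volume := by
  have hm : (fun ξ : E => (((1 + ‖ξ‖ ^ 2) ^ (s / 2) : ℝ) : ℂ)).HasTemperateGrowth := by fun_prop
  have hpair : ∀ φ : 𝓢(E, ℂ), (TemperedDistribution.smulLeftCLM ℂ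
      (fun ξ : E => (((1 + ‖ξ‖ ^ 2) ^ (s / 2) : ℝ) : ℂ)) (𝓕 (hf2.toLp f : 𝓢'(E, ℂ)))) φ =
      ∫ ξ, φ ξ • ((((1 + ‖ξ‖ ^ 2) ^ (s / 2) : ℝ) : ℂ) * 𝓕 f ξ) := by
    intro φ
    rw [TemperedDistribution.smulLeftCLM_apply_apply, Lp.fourier_toTemperedDistribution_eq,
      Lp.toTemperedDistribution_apply]
    refine integral_congr_ae ?_
    filter_upwards [fourier_toLp_ae_eq hf hf2] with ξ hξ
    rw [hξ, SchwartzMap.smulLeftCLM_apply_apply hm]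
    simp only [smul_eq_mul]
    ring
  have hcont : Continuous fun ξ : E => (((1 + ‖ξ‖ ^ 2) ^ (s / 2) : ℝ) : ℂ) * 𝓕 f ξ :=
    hm.1.continuous.mul (continuous_fourier hf)
  rw [TemperedDistribution.memSobolev_iff_exists_smulLeftCLM_fourier]
  constructor
  · rintro ⟨g, hg⟩
    refine (memLp_congr_ae ?_).1 (Lp.memLp g)
    refine ae_eq_of_integral_schwartz_smul_eq ((Lp.memLp _).locallyIntegrable (by norm_num))
      hcont.locallyIntegrable fun φ => ?_
    rw [← hpair, hg, Lp.toTemperedDistribution_apply]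
  · intro h
    refine ⟨h.toLp _, ?_⟩
    ext φ
    rw [hpair, Lp.toTemperedDistribution_apply]
    refine integral_congr_ae ?_
    filter_upwards [h.coeFn_toLp] with ξ hξ
    rw [hξ]

lemma memLp_two_pi_norm_rpow_mul {g : E → ℂ} (hg : Continuous g) (hs : 0 ≤ s)
    (h : MemLp (fun ξ : E => (((1 + ‖ξ‖ ^ 2) ^ (s / 2) : ℝ) : ℂ) * g ξ) 2 volume) :
    MemLp (fun ξ : E => (((2 * Real.pi * ‖ξ‖) ^ s : ℝ) : ℂ) * g ξ) 2 volume := by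
  refine MemLp.of_le_mul (c := (2 * Real.pi) ^ s) h ((Complex.continuous_ofReal.comp
    (continuous_two_pi_norm_rpow hs)).mul hg).aestronglyMeasurable
    (Eventually.of_forall fun ξ => ?_)
  rw [norm_mul, norm_mul, Complex.norm_real, Complex.norm_real, Real.norm_eq_abs,
    Real.norm_eq_abs, abs_of_nonneg (by positivity), abs_of_nonneg (by positivity), ← mul_assoc]
  exact mul_le_mul_of_nonneg_right (two_pi_norm_rpow_le hs ξ) (norm_nonneg _)

lemma memLp_one_add_norm_sq_rpow_mul {g : E → ℂ} (hg : Continuous g) (hs : 0 ≤ s)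
    (h0 : MemLp g 2 volume)
    (h : MemLp (fun ξ : E => (((2 * Real.pi * ‖ξ‖) ^ s : ℝ) : ℂ) * g ξ) 2 volume) :
    MemLp (fun ξ : E => (((1 + ‖ξ‖ ^ 2) ^ (s / 2) : ℝ) : ℂ) * g ξ) 2 volume := by
  have hm : (fun ξ : E => (((1 + ‖ξ‖ ^ 2) ^ (s / 2) : ℝ) : ℂ)).HasTemperateGrowth := by fun_prop
  refine MemLp.of_le_mul (c := 2 ^ (s / 2)) (h0.norm.add h.norm)
    (hm.1.continuous.mul hg).aestronglyMeasurable (Eventually.of_forall fun ξ => ?_)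
  simp only [Pi.add_apply]
  rw [norm_mul, norm_mul, Complex.norm_real, Complex.norm_real, Real.norm_eq_abs,
    Real.norm_eq_abs, abs_of_nonneg (by positivity), abs_of_nonneg (by positivity),
    Real.norm_eq_abs, abs_of_nonneg (by positivity)]
  have := mul_le_mul_of_nonneg_right (one_add_norm_sq_rpow_le hs ξ) (norm_nonneg (g ξ))
  linarith

lemma memLp_two_pi_norm_rpow_mul_fourier_schwartz (hs : 0 ≤ s) (φ : 𝓢(E, ℂ)) :
    MemLp (fun ξ : E => (((2 * Real.pi * ‖ξ‖) ^ s : ℝ) : ℂ) * (𝓕 φ) ξ) 2 volume := by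
  have hm : (fun ξ : E => (((1 + ‖ξ‖ ^ 2) ^ (s / 2) : ℝ) : ℂ)).HasTemperateGrowth := by fun_prop
  refine memLp_two_pi_norm_rpow_mul (𝓕 φ).continuous hs ?_
  have := (SchwartzMap.smulLeftCLM ℂ
    (fun ξ : E => (((1 + ‖ξ‖ ^ 2) ^ (s / 2) : ℝ) : ℂ)) (𝓕 φ)).memLp 2 (volume : Measure E)
  refine (memLp_congr_ae (Eventually.of_forall fun ξ => ?_)).1 this
  rw [SchwartzMap.smulLeftCLM_apply_apply hm, smul_eq_mul]

/-- Split the weight evenly between the factors: a product of two `L²` functions is integrable. -/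
lemma integrable_rpow_mul_mul_conj {g h : E → ℂ}
    (hg : MemLp (fun ξ : E => (((2 * Real.pi * ‖ξ‖) ^ s : ℝ) : ℂ) * g ξ) 2 volume)
    (hh : MemLp (fun ξ : E => (((2 * Real.pi * ‖ξ‖) ^ s : ℝ) : ℂ) * h ξ) 2 volume) :
    Integrable fun ξ : E => (((2 * Real.pi * ‖ξ‖) ^ (2 * s) : ℝ) : ℂ) * g ξ * conj (h ξ) := by
  have := hg.integrable_mul hh.star
  refine this.congr (Eventually.of_forall fun ξ => ?_)
  have e : (2 * Real.pi * ‖ξ‖) ^ (2 * s) =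
      (2 * Real.pi * ‖ξ‖) ^ s * (2 * Real.pi * ‖ξ‖) ^ s := by
    rw [two_mul s, ← pow_two, ← Real.rpow_natCast, ← Real.rpow_mul (by positivity)]
    congr 1
    push_cast
    ring
  simp only [Pi.mul_apply, Pi.star_apply, e]
  rw [RCLike.star_def, map_mul, Complex.conj_ofReal]
  push_cast
  ring

lemma fracLaplacianPairing_toLp {n : ℕ} {f : EuclideanSpace ℝ (Fin n) → ℂ} (hf : Integrable f)
    (hf2 : MemLp f 2 volume) (φ : EuclideanSpace ℝ (Fin n) → ℝ) :
    fracLaplacianPairing s (hf2.toLp f) φ = ∫ ξ : EuclideanSpace ℝ (Fin n),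
      (((2 * Real.pi * ‖ξ‖) ^ (2 * s) : ℝ) : ℂ) * 𝓕 f ξ *
        conj (𝓕 (fun x => (φ x : ℂ)) ξ) := by
  refine integral_congr_ae ?_
  filter_upwards [fourier_toLp_ae_eq hf hf2] with ξ hξ
  rw [hξ]

lemma memLp_fourier {f : E → ℂ} (hf : Integrable f) (hf2 : MemLp f 2 volume) :
    MemLp (𝓕 f) 2 volume :=
  (memLp_congr_ae (fourier_toLp_ae_eq hf hf2)).1 (Lp.memLp _)

lemma ae_eq_zero_of_fourier_ae_eq_zero {f : E → ℂ} (hf : Integrable f) (hf2 : MemLp f 2 volume)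
    (h : 𝓕 f =ᵐ[volume] 0) : f =ᵐ[volume] 0 := by
  have h1 : 𝓕 (hf2.toLp f) = 0 := by
    rw [Lp.eq_zero_iff_ae_eq_zero]
    exact (fourier_toLp_ae_eq hf hf2).trans h
  have h2 : hf2.toLp f = 0 := by
    rw [← norm_eq_zero, ← Lp.norm_fourier_eq, h1, norm_zero]
  exact hf2.coeFn_toLp.symm.trans ((Lp.eq_zero_iff_ae_eq_zero).1 h2)

end Bridge

/-! ### Uniqueness by dilation. -/

section Uniqueness

variable {E : Type*} [NormedAddCommGroup E] [InnerProductSpace ℝ E] [FiniteDimensional ℝ E]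
  [MeasurableSpace E] [BorelSpace E] {s : ℝ}

lemma fourier_comp_smul (f : E → ℂ) {l : ℝ} (hl : 0 < l) (ξ : E) :
    𝓕 (fun x => f (l • x)) ξ = ((l ^ Module.finrank ℝ E)⁻¹ : ℝ) * 𝓕 f (l⁻¹ • ξ) := by
  rw [Real.fourier_eq, Real.fourier_eq, ← Complex.real_smul]
  have := Measure.integral_comp_smul_of_nonneg (volume : Measure E)
    (fun y : E => Real.fourierChar (-(inner ℝ y (l⁻¹ • ξ))) • f y) l (hR := hl.le)
  rw [← this]
  congr 1
  ext x
  rw [real_inner_smul_left, real_inner_smul_right, ← mul_assoc, mul_inv_cancel₀ hl.ne', one_mul]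

lemma norm_fourier_normed_le (b : ContDiffBump (0 : E)) (ξ : E) :
    ‖𝓕 (fun x => (b.normed volume x : ℂ)) ξ‖ ≤ 1 := by
  rw [fourier_ofReal_apply]
  refine (norm_integral_le_integral_norm _).trans (le_of_eq ?_)
  rw [← b.integral_normed (μ := volume)]
  congr 1
  ext x
  rw [norm_smul, ← neg_mul, ← Complex.ofReal_neg, Complex.norm_exp_ofReal_mul_I, mul_one,
    Real.norm_eq_abs, abs_of_nonneg (b.nonneg_normed x)]

/-- The transform at `ξ` is the convolution at `0` of the bump with the character `x ↦ exp (2πi⟨x,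
ξ⟩)`, whose value at `0` is `1`. -/
lemma tendsto_fourier_normed {b : ℕ → ContDiffBump (0 : E)}
    (hb : Tendsto (fun k => (b k).rOut) atTop (𝓝 0)) (ξ : E) :
    Tendsto (fun k => 𝓕 (fun x => ((b k).normed volume x : ℂ)) ξ) atTop (𝓝 1) := by
  have hc : Continuous fun x : E => Complex.exp ((2 * Real.pi * inner ℝ x ξ : ℝ) * Complex.I) := by
    fun_prop
  have h := ContDiffBump.convolution_tendsto_right (μ := (volume : Measure E)) (φ := b)
    (g := fun _ x => Complex.exp ((2 * Real.pi * inner ℝ x ξ : ℝ) * Complex.I))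
    (k := fun _ => 0) (x₀ := 0) (z₀ := 1) hb
    (Eventually.of_forall fun _ => hc.aestronglyMeasurable)
    (by
      have h1 : Tendsto (fun x : E => Complex.exp ((2 * Real.pi * inner ℝ x ξ : ℝ) * Complex.I))
          (𝓝 0) (𝓝 1) := by simpa using hc.tendsto 0
      exact h1.comp tendsto_snd) tendsto_const_nhds
  refine h.congr fun k => ?_
  rw [fourier_ofReal_apply, convolution_def]
  congr 1
  ext x
  simp

lemma ofReal_convolution (f g : E → ℝ) (x : E) :
    ((convolution f g (ContinuousLinearMap.lsmul ℝ ℝ) volume x : ℝ) : ℂ) =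
      convolution (fun y => (f y : ℂ)) (fun y => (g y : ℂ)) (ContinuousLinearMap.mul ℂ ℂ)
        volume x := by
  rw [convolution_def, convolution_def, ← integral_complex_ofReal]
  congr 1
  ext t
  simp

/-- The energy pairing of `w` with a dilation of `w` vanishes. -/
lemma integral_mul_conj_fourier_comp_smul_eq_zero {w : E → ℝ} (hw : Integrable w)
    (hsupp : Function.support w ⊆ ball 0 1)
    (hg : MemLp (fun ξ : E => (((2 * Real.pi * ‖ξ‖) ^ s : ℝ) : ℂ) *
      𝓕 (fun x => (w x : ℂ)) ξ) 2 volume)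
    (horth : ∀ φ : E → ℝ, ContDiff ℝ ∞ φ → HasCompactSupport φ → tsupport φ ⊆ ball 0 1 →
      ∫ ξ : E, (((2 * Real.pi * ‖ξ‖) ^ (2 * s) : ℝ) : ℂ) * 𝓕 (fun x => (w x : ℂ)) ξ *
        conj (𝓕 (fun x => (φ x : ℂ)) ξ) = 0) {l : ℝ} (hl : 1 < l)
    (hgl : MemLp (fun ξ : E => (((2 * Real.pi * ‖ξ‖) ^ s : ℝ) : ℂ) *
      𝓕 (fun x => (w (l • x) : ℂ)) ξ) 2 volume) :
    ∫ ξ : E, (((2 * Real.pi * ‖ξ‖) ^ (2 * s) : ℝ) : ℂ) * 𝓕 (fun x => (w x : ℂ)) ξ *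
        conj (𝓕 (fun x => (w (l • x) : ℂ)) ξ) = 0 := by
  have hl0 : 0 < l := by linarith
  have hwl : Integrable fun x => w (l • x) := hw.comp_smul hl0.ne'
  have hsl : Function.support (fun x => w (l • x)) ⊆ ball 0 l⁻¹ := by
    intro x hx
    have : l • x ∈ ball (0 : E) 1 := hsupp hx
    rw [mem_ball_zero_iff, norm_smul, Real.norm_eq_abs, abs_of_pos hl0] at this
    rw [mem_ball_zero_iff, ← one_div, lt_div_iff₀ hl0]
    linarith
  have hl1 : l⁻¹ < 1 := inv_lt_one_of_one_lt₀ hl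
  -- The dilation `w(l x)` lives in the ball of radius `l⁻¹`, so mollifying at a scale below `1 -
  -- l⁻¹` stays inside the unit ball. The denominator `k + 2` keeps this strict already at `k = 0`.
  set δ : ℕ → ℝ := fun k => (1 - l⁻¹) * (1 / ((k : ℝ) + 2)) with hδ
  have hδpos : ∀ k, 0 < δ k := fun k => mul_pos (by linarith) (by positivity)
  have hδlt : ∀ k, δ k < 1 - l⁻¹ := fun k => by
    refine mul_lt_of_lt_one_right (by linarith) ?_
    rw [div_lt_one (by positivity)]
    have : (0 : ℝ) ≤ k := by positivity
    linarith
  set b : ℕ → ContDiffBump (0 : E) := fun k =>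
    ⟨δ k / 2, δ k, by have := hδpos k; linarith, by have := hδpos k; linarith⟩ with hb
  have hblim : Tendsto (fun k => (b k).rOut) atTop (𝓝 0) := by
    have h1 : Tendsto (fun k : ℕ => 1 / ((k : ℝ) + 2)) atTop (𝓝 0) :=
      tendsto_const_nhds.div_atTop (tendsto_atTop_add_const_right _ _ tendsto_natCast_atTop_atTop)
    simpa [hb, hδ] using h1.const_mul (1 - l⁻¹)
  set φ : ℕ → E → ℝ := fun k => convolution ((b k).normed volume) (fun x => w (l • x))
    (ContinuousLinearMap.lsmul ℝ ℝ) volume with hφ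
  have hφsub : ∀ k, tsupport (φ k) ⊆ closedBall 0 (δ k + l⁻¹) := by
    intro k
    refine closure_minimal ?_ isClosed_closedBall
    refine (support_convolution_subset _).trans ?_
    rintro _ ⟨x, hx, y, hy, rfl⟩
    rw [(b k).support_normed_eq] at hx
    have h1 := mem_ball_zero_iff.1 hx
    have h2 := mem_ball_zero_iff.1 (hsl hy)
    rw [mem_closedBall_zero_iff]
    exact (norm_add_le x y).trans (add_le_add h1.le h2.le)
  have hzero : ∀ k, ∫ ξ : E, (((2 * Real.pi * ‖ξ‖) ^ (2 * s) : ℝ) : ℂ) *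
      𝓕 (fun x => (w x : ℂ)) ξ * conj (𝓕 (fun x => ((b k).normed volume x : ℂ)) ξ *
        𝓕 (fun x => (w (l • x) : ℂ)) ξ) = 0 := by
    intro k
    rw [← horth (φ k) ((b k).hasCompactSupport_normed.contDiff_convolution_left _
      (b k).contDiff_normed hwl.locallyIntegrable)
      (HasCompactSupport.of_support_subset_isCompact (isCompact_closedBall 0 (δ k + l⁻¹))
        (subset_closure.trans (hφsub k)))
      ((hφsub k).trans (closedBall_subset_ball (by have := hδlt k; linarith)))]
    congr 1
    ext ξ
    have e1 := Real.fourier_mul_convolution_eq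
      (f₁ := fun x => ((b k).normed volume x : ℂ)) (f₂ := fun x => (w (l • x) : ℂ))
      ((b k).continuous_normed.integrable_of_hasCompactSupport
        (b k).hasCompactSupport_normed).ofReal hwl.ofReal ξ
    have e2 : (fun x => (φ k x : ℂ)) = convolution (fun x => ((b k).normed volume x : ℂ))
        (fun x => (w (l • x) : ℂ)) (ContinuousLinearMap.mul ℂ ℂ) volume := by
      ext x
      exact ofReal_convolution _ _ x
    rw [e2, ← e1]
  have hlim : Tendsto (fun k => ∫ ξ : E, (((2 * Real.pi * ‖ξ‖) ^ (2 * s) : ℝ) : ℂ) *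
      𝓕 (fun x => (w x : ℂ)) ξ * conj (𝓕 (fun x => ((b k).normed volume x : ℂ)) ξ *
        𝓕 (fun x => (w (l • x) : ℂ)) ξ)) atTop
      (𝓝 (∫ ξ : E, (((2 * Real.pi * ‖ξ‖) ^ (2 * s) : ℝ) : ℂ) * 𝓕 (fun x => (w x : ℂ)) ξ *
        conj (𝓕 (fun x => (w (l • x) : ℂ)) ξ))) := by
    have hint := integrable_rpow_mul_mul_conj hg hgl
    refine tendsto_integral_of_dominated_convergence _ (fun k => ?_) hint.norm
      (fun k => Eventually.of_forall fun ξ => ?_) (Eventually.of_forall fun ξ => ?_)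
    · have h1 : AEStronglyMeasurable (fun ξ : E =>
          conj (𝓕 (fun x => ((b k).normed volume x : ℂ)) ξ)) volume :=
        (Complex.continuous_conj.comp (continuous_fourier
          ((b k).continuous_normed.integrable_of_hasCompactSupport
            (b k).hasCompactSupport_normed).ofReal)).aestronglyMeasurable
      refine (hint.aestronglyMeasurable.mul h1).congr (Eventually.of_forall fun ξ => ?_)
      simp only [Pi.mul_apply, map_mul]
      ring
    · rw [map_mul, ← mul_assoc, mul_right_comm, norm_mul _ (conj (𝓕 (fun x =>
        ((b k).normed volume x : ℂ)) ξ)), RCLike.norm_conj]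
      exact mul_le_of_le_one_right (norm_nonneg _) (norm_fourier_normed_le (b k) ξ)
    · refine Tendsto.const_mul _ ?_
      have h1 := (tendsto_fourier_normed hblim ξ).mul_const (𝓕 (fun x => (w (l • x) : ℂ)) ξ)
      rw [one_mul] at h1
      exact (Complex.continuous_conj.tendsto _).comp h1
  simp_rw [hzero] at hlim
  exact (tendsto_nhds_unique hlim tendsto_const_nhds)

lemma memLp_two_comp_smul {g : E → ℂ} (hg : MemLp g 2 volume) (hgc : Continuous g) {r : ℝ}
    (hr : r ≠ 0) : MemLp (fun ξ => g (r • ξ)) 2 volume := by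
  have hc : Continuous fun ξ : E => g (r • ξ) := hgc.comp (continuous_const_smul r)
  rw [memLp_two_iff_integrable_sq_norm hc.aestronglyMeasurable]
  exact ((memLp_two_iff_integrable_sq_norm hgc.aestronglyMeasurable).1 hg).comp_smul hr

/-- A continuous `L²` function orthogonal to all its dilations vanishes. -/
lemma ae_eq_zero_of_integral_mul_conj_comp_smul_eq_zero {g : E → ℂ} (hg : MemLp g 2 volume)
    (hgc : Continuous g) (h : ∀ l : ℝ, 1 < l → ∫ ξ, g ξ * conj (g (l⁻¹ • ξ)) = 0) :
    g =ᵐ[volume] 0 := by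
  set N := ∫ ξ, ‖g ξ‖ ^ 2 with hN
  have hN0 : 0 ≤ N := integral_nonneg fun ξ => by positivity
  have hsq := (memLp_two_iff_integrable_sq_norm hgc.aestronglyMeasurable).1 hg
  set l : ℕ → ℝ := fun k => 1 + 1 / ((k : ℝ) + 1) with hl
  have hl1 : ∀ k, 1 < l k := fun k => by
    have : (0 : ℝ) < 1 / ((k : ℝ) + 1) := by positivity
    simp only [hl]
    linarith
  have hllim : Tendsto l atTop (𝓝 1) := by
    simpa [hl] using tendsto_one_div_add_atTop_nhds_zero_nat (𝕜 := ℝ) |>.const_add 1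
  -- Orthogonality removes the cross term; the second summand is the Jacobian of the dilation.
  have hnorm : ∀ k, ∫ ξ, ‖g ξ + g ((l k)⁻¹ • ξ)‖ ^ 2 =
      N + l k ^ Module.finrank ℝ E * N := by
    intro k
    have hlk : 0 < l k := by linarith [hl1 k]
    have hgk := memLp_two_comp_smul hg hgc (inv_ne_zero hlk.ne')
    have hsqk := (memLp_two_iff_integrable_sq_norm hgk.aestronglyMeasurable).1 hgk
    have hcross : Integrable fun ξ => g ξ * conj (g ((l k)⁻¹ • ξ)) := hg.integrable_mul hgk.star
    have e : ∀ ξ, ‖g ξ + g ((l k)⁻¹ • ξ)‖ ^ 2 = ‖g ξ‖ ^ 2 + ‖g ((l k)⁻¹ • ξ)‖ ^ 2 +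
        2 * (g ξ * conj (g ((l k)⁻¹ • ξ))).re := by
      intro ξ
      rw [← Complex.normSq_eq_norm_sq, ← Complex.normSq_eq_norm_sq, ← Complex.normSq_eq_norm_sq,
        Complex.normSq_add]
    have hre : ∫ ξ, (g ξ * conj (g ((l k)⁻¹ • ξ))).re = 0 := by
      have := integral_re hcross
      rw [h _ (hl1 k)] at this
      simpa using this
    have hscale : ∫ ξ, ‖g ((l k)⁻¹ • ξ)‖ ^ 2 = l k ^ Module.finrank ℝ E * N := by
      rw [Measure.integral_comp_inv_smul_of_nonneg volume (fun ξ => ‖g ξ‖ ^ 2) hlk.le,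
        smul_eq_mul]
    have hre_int : Integrable fun ξ => 2 * (g ξ * conj (g ((l k)⁻¹ • ξ))).re :=
      hcross.re.const_mul 2
    have hadd : Integrable fun ξ => ‖g ξ‖ ^ 2 + ‖g ((l k)⁻¹ • ξ)‖ ^ 2 := hsq.add hsqk
    simp_rw [e]
    rw [integral_add hadd hre_int, integral_add hsq hsqk, integral_const_mul, hre, hscale]
    ring
  -- Pointwise convergence from continuity of `g`, together with Fatou's lemma, takes the place of
  -- continuity of dilations in `L²`. The left side is `4N`, so `4N ≤ 2N` forces `N = 0`.
  have hint2 : ∫⁻ ξ, ENNReal.ofReal ((2 * ‖g ξ‖) ^ 2) ≤ ENNReal.ofReal (2 * N) := by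
    have hpt : ∀ ξ, Tendsto (fun k => ENNReal.ofReal (‖g ξ + g ((l k)⁻¹ • ξ)‖ ^ 2)) atTop
        (𝓝 (ENNReal.ofReal ((2 * ‖g ξ‖) ^ 2))) := by
      intro ξ
      refine (ENNReal.continuous_ofReal.tendsto _).comp ?_
      have h1 : Tendsto (fun k => (l k)⁻¹ • ξ) atTop (𝓝 ξ) := by
        simpa using (hllim.inv₀ one_ne_zero).smul_const ξ
      have h2 := (((hgc.tendsto ξ).comp h1).const_add (g ξ)).norm.pow 2
      have e : ‖g ξ + g ξ‖ = 2 * ‖g ξ‖ := by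
        rw [← two_mul, norm_mul]
        simp
      rw [e] at h2
      exact h2
    have hlimN : Tendsto (fun k => ENNReal.ofReal (N + l k ^ Module.finrank ℝ E * N)) atTop
        (𝓝 (ENNReal.ofReal (2 * N))) := by
      refine (ENNReal.continuous_ofReal.tendsto _).comp ?_
      have := ((hllim.pow (Module.finrank ℝ E)).mul_const N).const_add N
      rw [one_pow, one_mul] at this
      rwa [two_mul]
    calc ∫⁻ ξ, ENNReal.ofReal ((2 * ‖g ξ‖) ^ 2)
        = ∫⁻ ξ, liminf (fun k => ENNReal.ofReal (‖g ξ + g ((l k)⁻¹ • ξ)‖ ^ 2)) atTop :=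
          lintegral_congr fun ξ => (hpt ξ).liminf_eq.symm
      _ ≤ liminf (fun k => ∫⁻ ξ, ENNReal.ofReal (‖g ξ + g ((l k)⁻¹ • ξ)‖ ^ 2)) atTop := by
          refine lintegral_liminf_le fun k => ?_
          have : Continuous fun ξ => ‖g ξ + g ((l k)⁻¹ • ξ)‖ ^ 2 :=
            (hgc.add (hgc.comp (continuous_const_smul _))).norm.pow 2
          exact (ENNReal.continuous_ofReal.comp this).measurable
      _ = liminf (fun k => ENNReal.ofReal (N + l k ^ Module.finrank ℝ E * N)) atTop := by
          congr 1
          ext k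
          have hlk : 0 < l k := by linarith [hl1 k]
          have hgk := memLp_two_comp_smul hg hgc (inv_ne_zero hlk.ne')
          have hadd : MemLp (fun ξ => g ξ + g ((l k)⁻¹ • ξ)) 2 volume := hg.add hgk
          rw [← hnorm, ofReal_integral_eq_lintegral_ofReal
            ((memLp_two_iff_integrable_sq_norm hadd.aestronglyMeasurable).1 hadd)
            (Eventually.of_forall fun ξ => by simp only [Pi.zero_apply]; positivity)]
      _ = ENNReal.ofReal (2 * N) := hlimN.liminf_eq
  have h4 : ENNReal.ofReal (4 * N) ≤ ENNReal.ofReal (2 * N) := by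
    refine le_trans (le_of_eq ?_) hint2
    rw [hN, ← integral_const_mul, ofReal_integral_eq_lintegral_ofReal (hsq.const_mul 4)
      (Eventually.of_forall fun ξ => by simp only [Pi.zero_apply]; positivity)]
    congr 1
    ext ξ
    congr 1
    ring
  have hNz : N = 0 := by
    have := (ENNReal.ofReal_le_ofReal_iff (by linarith)).1 h4
    linarith
  have := (integral_eq_zero_iff_of_nonneg (fun ξ => by simp only [Pi.zero_apply]; positivity)
    hsq).1 hNz
  filter_upwards [this] with ξ hξ
  simpa using hξ

/-- An `H^s` function supported in the unit ball and `(-Δ)^s`-orthogonal to all test functions in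
the ball vanishes. -/
lemma ae_eq_zero_of_orthogonal [Nontrivial E] (hs : 0 ≤ s) {w : E → ℝ} (hw : Integrable w)
    (hw2 : MemLp (fun x => (w x : ℂ)) 2 volume) (hsupp : Function.support w ⊆ ball 0 1)
    (hg : MemLp (fun ξ : E => (((2 * Real.pi * ‖ξ‖) ^ s : ℝ) : ℂ) *
      𝓕 (fun x => (w x : ℂ)) ξ) 2 volume)
    (horth : ∀ φ : E → ℝ, ContDiff ℝ ∞ φ → HasCompactSupport φ → tsupport φ ⊆ ball 0 1 →
      ∫ ξ : E, (((2 * Real.pi * ‖ξ‖) ^ (2 * s) : ℝ) : ℂ) * 𝓕 (fun x => (w x : ℂ)) ξ *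
        conj (𝓕 (fun x => (φ x : ℂ)) ξ) = 0) : w =ᵐ[volume] 0 := by
  set g : E → ℂ := fun ξ => (((2 * Real.pi * ‖ξ‖) ^ s : ℝ) : ℂ) * 𝓕 (fun x => (w x : ℂ)) ξ
  have hgc : Continuous g := (Complex.continuous_ofReal.comp
    (continuous_two_pi_norm_rpow hs)).mul (continuous_fourier hw.ofReal)
  -- By homogeneity of the weight, dilating `w` dilates `g` up to a positive constant, so the
  -- vanishing energy pairings say that `g` is orthogonal to its dilations.
  have hdil : ∀ l : ℝ, 1 < l → ∀ ξ : E, (((2 * Real.pi * ‖ξ‖) ^ s : ℝ) : ℂ) *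
      𝓕 (fun x => (w (l • x) : ℂ)) ξ =
      ((l ^ s * (l ^ Module.finrank ℝ E)⁻¹ : ℝ) : ℂ) * g (l⁻¹ • ξ) := by
    intro l hl ξ
    have hl0 : 0 < l := by linarith
    rw [fourier_comp_smul (fun x => (w x : ℂ)) hl0]
    have e : (2 * Real.pi * ‖ξ‖) ^ s = l ^ s * (2 * Real.pi * ‖l⁻¹ • ξ‖) ^ s := by
      rw [← Real.mul_rpow hl0.le (by positivity), norm_smul, norm_inv, Real.norm_eq_abs,
        abs_of_pos hl0]
      congr 1
      field_simp
    simp only [g]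
    rw [e]
    push_cast
    ring
  have hgz : g =ᵐ[volume] 0 := by
    refine ae_eq_zero_of_integral_mul_conj_comp_smul_eq_zero hg hgc fun l hl => ?_
    have hl0 : 0 < l := by linarith
    set c : ℝ := l ^ s * (l ^ Module.finrank ℝ E)⁻¹ with hc
    have hc0 : (c : ℂ) ≠ 0 := by
      have : 0 < c := by positivity
      exact_mod_cast this.ne'
    have hgl : MemLp (fun ξ : E => (((2 * Real.pi * ‖ξ‖) ^ s : ℝ) : ℂ) *
        𝓕 (fun x => (w (l • x) : ℂ)) ξ) 2 volume := by
      simp_rw [hdil l hl]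
      exact (memLp_two_comp_smul hg hgc (inv_ne_zero hl0.ne')).const_mul _
    have key := integral_mul_conj_fourier_comp_smul_eq_zero hw hsupp hg horth hl hgl
    have e : ∀ ξ : E, (((2 * Real.pi * ‖ξ‖) ^ (2 * s) : ℝ) : ℂ) * 𝓕 (fun x => (w x : ℂ)) ξ *
        conj (𝓕 (fun x => (w (l • x) : ℂ)) ξ) = c * (g ξ * conj (g (l⁻¹ • ξ))) := by
      intro ξ
      have e1 : (((2 * Real.pi * ‖ξ‖) ^ (2 * s) : ℝ) : ℂ) =
          (((2 * Real.pi * ‖ξ‖) ^ s : ℝ) : ℂ) * (((2 * Real.pi * ‖ξ‖) ^ s : ℝ) : ℂ) := by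
        rw [← Complex.ofReal_mul, two_mul s, ← pow_two, ← Real.rpow_natCast,
          ← Real.rpow_mul (by positivity)]
        congr 2
        push_cast
        ring
      have e2 := congrArg conj (hdil l hl ξ)
      rw [map_mul, map_mul, Complex.conj_ofReal, Complex.conj_ofReal] at e2
      simp only [g] at e2 ⊢
      rw [e1]
      linear_combination ((((2 * Real.pi * ‖ξ‖) ^ s : ℝ) : ℂ) * 𝓕 (fun x => (w x : ℂ)) ξ) * e2
    simp_rw [e] at key
    rw [integral_const_mul] at key
    exact (mul_eq_zero.1 key).resolve_left hc0
  have hz : 𝓕 (fun x => (w x : ℂ)) =ᵐ[volume] 0 := by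
    -- The weight vanishes only at the origin, a null set because `E` is nontrivial.
    have h0 : ∀ᵐ ξ : E ∂volume, ξ ≠ 0 := by
      rw [ae_iff]
      simp
    filter_upwards [hgz, h0] with ξ hξ hξ0
    have hpos : 0 < (2 * Real.pi * ‖ξ‖) ^ s := by
      have : 0 < ‖ξ‖ := norm_pos_iff.2 hξ0
      positivity
    have hne : (((2 * Real.pi * ‖ξ‖) ^ s : ℝ) : ℂ) ≠ 0 := by exact_mod_cast hpos.ne'
    exact (mul_eq_zero.1 hξ).resolve_left hne
  filter_upwards [ae_eq_zero_of_fourier_ae_eq_zero hw.ofReal hw2 hz] with x hx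
  simpa using hx

end Uniqueness

/-! ### The normalized profile and the two implications. -/

section Torsion

variable {m : ℕ} {s : ℝ}

lemma memLp_rpow_mul_fourier_bubble (hs : 0 < s) :
    MemLp (fun ξ : EuclideanSpace ℝ (Fin (m + 1)) => (((2 * Real.pi * ‖ξ‖) ^ s : ℝ) : ℂ) *
      𝓕 (fun x : EuclideanSpace ℝ (Fin (m + 1)) => (bubble s x : ℂ)) ξ) 2 volume := by
  have hc : Continuous fun ξ : EuclideanSpace ℝ (Fin (m + 1)) =>
      (((2 * Real.pi * ‖ξ‖) ^ s : ℝ) : ℂ) *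
        𝓕 (fun x : EuclideanSpace ℝ (Fin (m + 1)) => (bubble s x : ℂ)) ξ :=
    (Complex.continuous_ofReal.comp (continuous_two_pi_norm_rpow hs.le)).mul
      (continuous_fourier (integrable_bubble hs).ofReal)
  rw [memLp_two_iff_integrable_sq_norm hc.aestronglyMeasurable]
  refine (integrable_rpow_mul_fourier_bubble_sq hs).congr (Eventually.of_forall fun ξ => ?_)
  beta_reduce
  rw [norm_mul, mul_pow, Complex.norm_real, Real.norm_eq_abs, sq_abs, two_mul s,
    Real.rpow_add_of_nonneg (by positivity) hs.le hs.le, sq ((2 * Real.pi * ‖ξ‖) ^ s)]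

lemma memLp_bubble (hs : 0 < s) :
    MemLp (fun x : EuclideanSpace ℝ (Fin (m + 1)) => (bubble s x : ℂ)) 2 volume :=
  (Complex.continuous_ofReal.comp (continuous_bubble hs)).memLp_of_hasCompactSupport
    ((hasCompactSupport_bubble hs).comp_left (g := Complex.ofReal) Complex.ofReal_zero)

lemma fourier_const_mul_bubble (κ : ℝ) (ξ : EuclideanSpace ℝ (Fin (m + 1))) :
    𝓕 (fun x : EuclideanSpace ℝ (Fin (m + 1)) => ((κ * bubble s x : ℝ) : ℂ)) ξ =
      κ * 𝓕 (fun x : EuclideanSpace ℝ (Fin (m + 1)) => (bubble s x : ℂ)) ξ := by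
  rw [Real.fourier_eq, Real.fourier_eq, ← integral_const_mul]
  congr 1
  ext x
  rw [Complex.ofReal_mul, Circle.smul_def, Circle.smul_def, smul_eq_mul, smul_eq_mul]
  ring

lemma memLp_rpow_mul_fourier_const_mul_bubble (hs : 0 < s) (κ : ℝ) :
    MemLp (fun ξ : EuclideanSpace ℝ (Fin (m + 1)) => (((2 * Real.pi * ‖ξ‖) ^ s : ℝ) : ℂ) *
      𝓕 (fun x : EuclideanSpace ℝ (Fin (m + 1)) => ((κ * bubble s x : ℝ) : ℂ)) ξ) 2 volume := by
  refine (memLp_congr_ae (Eventually.of_forall fun ξ => ?_)).1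
    ((memLp_rpow_mul_fourier_bubble hs).const_mul (κ : ℂ))
  rw [fourier_const_mul_bubble]
  ring

/-- The equation satisfied by the normalized bubble. -/
lemma integral_rpow_mul_fourier_const_mul_bubble (hs : 0 < s) {κ : ℝ}
    (hκ : κ * torsionConst m s = 1) {φ : EuclideanSpace ℝ (Fin (m + 1)) → ℝ}
    (hφ : ContDiff ℝ ∞ φ) (hc : HasCompactSupport φ) (hsub : tsupport φ ⊆ ball 0 1) :
    ∫ ξ : EuclideanSpace ℝ (Fin (m + 1)), (((2 * Real.pi * ‖ξ‖) ^ (2 * s) : ℝ) : ℂ) *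
      𝓕 (fun x : EuclideanSpace ℝ (Fin (m + 1)) => ((κ * bubble s x : ℝ) : ℂ)) ξ *
        conj (𝓕 (fun x => (φ x : ℂ)) ξ) =
        ((∫ x in ball 0 1, 1 * φ x : ℝ) : ℂ) := by
  have hint := integrable_rpow_mul_mul_conj (memLp_rpow_mul_fourier_bubble (m := m) hs)
    (memLp_two_pi_norm_rpow_mul_fourier_schwartz hs.le (schwartzOfReal hφ hc))
  have e : ∀ ξ : EuclideanSpace ℝ (Fin (m + 1)), (((2 * Real.pi * ‖ξ‖) ^ (2 * s) : ℝ) : ℂ) *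
      𝓕 (fun x : EuclideanSpace ℝ (Fin (m + 1)) => ((κ * bubble s x : ℝ) : ℂ)) ξ *
        conj (𝓕 (fun x => (φ x : ℂ)) ξ) =
      κ * ((((2 * Real.pi * ‖ξ‖) ^ (2 * s) : ℝ) : ℂ) *
        𝓕 (fun x : EuclideanSpace ℝ (Fin (m + 1)) => (bubble s x : ℂ)) ξ *
          conj (𝓕 (fun x => (φ x : ℂ)) ξ)) := by
    intro ξ
    rw [fourier_const_mul_bubble]
    ring
  simp_rw [e]
  rw [integral_const_mul, integral_rpow_mul_fourier_bubble_mul hs hφ.continuous hc hsub hint,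
    ← Complex.ofReal_mul, ← mul_assoc, hκ]
  simp_rw [one_mul]
  rw [setIntegral_eq_integral_of_forall_compl_eq_zero]
  exact fun x hx => image_eq_zero_of_notMem_tsupport fun h => hx (hsub h)

lemma isWeakDirichletSolution_of_ae_eq_bubble (hs : 0 < s) {κ : ℝ}
    (hκ : κ * torsionConst m s = 1) {u : EuclideanSpace ℝ (Fin (m + 1)) → ℝ}
    (hu : u =ᵐ[volume] fun x => κ * bubble s x) :
    IsWeakDirichletSolution s (ball 0 1) (fun _ => 1) u := by
  have hu' : (fun x => (u x : ℂ)) =ᵐ[volume] fun x => ((κ * bubble s x : ℝ) : ℂ) := by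
    filter_upwards [hu] with x hx
    rw [hx]
  have hb : Integrable (fun x : EuclideanSpace ℝ (Fin (m + 1)) => ((κ * bubble s x : ℝ) : ℂ)) :=
    ((integrable_bubble hs).const_mul κ).ofReal
  have hb2 : MemLp (fun x : EuclideanSpace ℝ (Fin (m + 1)) => ((κ * bubble s x : ℝ) : ℂ)) 2
      volume := by
    refine (memLp_congr_ae (Eventually.of_forall fun x => ?_)).1
      ((memLp_bubble hs).const_mul (κ : ℂ))
    exact (Complex.ofReal_mul _ _).symm
  have h1 : Integrable fun x => (u x : ℂ) := hb.congr hu'.symm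
  have h2 : MemLp (fun x => (u x : ℂ)) 2 volume := (memLp_congr_ae hu').2 hb2
  have hF := fourier_congr_ae hu'
  refine ⟨h2, ?_, ?_, fun φ hφ hc hsub => ?_⟩
  · refine (memSobolev_two_iff_memLp h1 h2).2 ?_
    rw [hF]
    exact memLp_one_add_norm_sq_rpow_mul (continuous_fourier hb) hs.le (memLp_fourier hb hb2)
      (memLp_rpow_mul_fourier_const_mul_bubble hs κ)
  · filter_upwards [hu] with x hx hxb
    rw [hx, bubble_of_one_le hs (by simpa using hxb), mul_zero]
  · rw [fracLaplacianPairing_toLp h1 h2, hF]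
    exact integral_rpow_mul_fourier_const_mul_bubble hs hκ hφ hc hsub

lemma ae_eq_bubble_of_isWeakDirichletSolution (hs : 0 < s) {κ : ℝ}
    (hκ : κ * torsionConst m s = 1) {u : EuclideanSpace ℝ (Fin (m + 1)) → ℝ}
    (hu : IsWeakDirichletSolution s (ball 0 1) (fun _ => 1) u) :
    u =ᵐ[volume] fun x => κ * bubble s x := by
  -- The solution vanishes outside the ball only almost everywhere; `v` is the representative
  -- supported in the ball. There `L²` is contained in `L¹`, which makes the Fourier integral
  -- available.
  set v : EuclideanSpace ℝ (Fin (m + 1)) → ℝ := (ball 0 1).indicator u with hv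
  have huv : (fun x => (u x : ℂ)) =ᵐ[volume] fun x => (v x : ℂ) := by
    filter_upwards [hu.eq_zero] with x hx
    by_cases h : x ∈ ball 0 1
    · rw [hv, Set.indicator_of_mem h]
    · rw [hv, Set.indicator_of_notMem h, hx h]
  have hv2 : MemLp (fun x => (v x : ℂ)) 2 volume := (memLp_congr_ae huv).1 hu.memLp
  have hvc : Integrable fun x => (v x : ℂ) := by
    rw [← integrableOn_iff_integrable_of_support_subset (s := ball 0 1)]
    · have : IsFiniteMeasure (volume.restrict
          (ball (0 : EuclideanSpace ℝ (Fin (m + 1))) 1)) :=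
        isFiniteMeasure_restrict.2 measure_ball_lt_top.ne
      exact (hv2.restrict _).integrable (by norm_num)
    · intro x hx
      by_contra h
      exact hx (by simp [hv, Set.indicator_of_notMem h])
  have huc : Integrable fun x => (u x : ℂ) := hvc.congr huv.symm
  have hF := fourier_congr_ae huv
  have hvr : Integrable v := by
    refine hvc.re.congr (Eventually.of_forall fun x => ?_)
    simp
  have hbr : Integrable fun x : EuclideanSpace ℝ (Fin (m + 1)) => κ * bubble s x :=
    (integrable_bubble hs).const_mul κ
  have hb2 : MemLp (fun x : EuclideanSpace ℝ (Fin (m + 1)) => ((κ * bubble s x : ℝ) : ℂ)) 2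
      volume := by
    refine (memLp_congr_ae (Eventually.of_forall fun x => ?_)).1
      ((memLp_bubble hs).const_mul (κ : ℂ))
    exact (Complex.ofReal_mul _ _).symm
  have hgv : MemLp (fun ξ : EuclideanSpace ℝ (Fin (m + 1)) =>
      (((2 * Real.pi * ‖ξ‖) ^ s : ℝ) : ℂ) * 𝓕 (fun x => (v x : ℂ)) ξ) 2 volume := by
    have := (memSobolev_two_iff_memLp huc hu.memLp).1 hu.memSobolev
    rw [hF] at this
    exact memLp_two_pi_norm_rpow_mul (continuous_fourier hvc) hs.le this
  have hgb := memLp_rpow_mul_fourier_const_mul_bubble (m := m) hs κ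
  have hsub : ∀ ξ, 𝓕 (fun x => ((v x - κ * bubble s x : ℝ) : ℂ)) ξ =
      𝓕 (fun x => (v x : ℂ)) ξ -
        𝓕 (fun x : EuclideanSpace ℝ (Fin (m + 1)) => ((κ * bubble s x : ℝ) : ℂ)) ξ := by
    intro ξ
    simp_rw [Complex.ofReal_sub]
    exact fourier_sub_apply hvc hbr.ofReal ξ
  have hw : (fun x => v x - κ * bubble s x) =ᵐ[volume] 0 := by
    refine ae_eq_zero_of_orthogonal hs.le (hvr.sub hbr) ?_ ?_ ?_ fun φ hφ hc hsupp => ?_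
    · simp_rw [Complex.ofReal_sub]
      exact hv2.sub hb2
    · intro x hx
      by_contra h
      refine hx ?_
      simp only [hv]
      rw [Set.indicator_of_notMem h, bubble_of_one_le hs (by simpa using h), mul_zero, sub_zero]
    · simp_rw [hsub, mul_sub]
      exact hgv.sub hgb
    · have hp := memLp_two_pi_norm_rpow_mul_fourier_schwartz hs.le (schwartzOfReal hφ hc)
      have e1 := hu.equation φ hφ hc hsupp
      rw [fracLaplacianPairing_toLp huc hu.memLp, hF] at e1
      have e2 := integral_rpow_mul_fourier_const_mul_bubble hs hκ hφ hc hsupp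
      have i1 := integrable_rpow_mul_mul_conj hgv hp
      have i2 := integrable_rpow_mul_mul_conj hgb hp
      have := integral_sub i1 i2
      simp_rw [hsub, mul_sub, sub_mul]
      refine this.trans ?_
      exact sub_eq_zero.2 (e1.trans e2.symm)
  filter_upwards [hu.eq_zero, hw] with x hx hwx
  have hwx' : v x - κ * bubble s x = 0 := hwx
  by_cases h : x ∈ ball 0 1
  · rw [hv, Set.indicator_of_mem h] at hwx'
    linarith
  · rw [hx h, bubble_of_one_le hs (by simpa using h), mul_zero]

end Torsion

theorem lemma2p2 (n : ℕ) (hn : 1 ≤ n) (s : ℝ) (hs : 1 < s) (hs_int : ∀ k : ℤ, s ≠ (k : ℝ))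
    (u : EuclideanSpace ℝ (Fin n) → ℝ) :
    IsWeakDirichletSolution s (Metric.ball 0 1) (fun _ => 1) u ↔
      (∀ᵐ x ∂MeasureTheory.volume, x ∈ Metric.ball (0 : EuclideanSpace ℝ (Fin n)) 1 →
        u x = (2 : ℝ) ^ (-(2 * s)) * Real.Gamma ((n : ℝ) / 2) /
          (Real.Gamma (((n : ℝ) + 2 * s) / 2) * Real.Gamma (1 + s)) * (1 - ‖x‖ ^ 2) ^ s) ∧
      (∀ᵐ x ∂MeasureTheory.volume, x ∉ Metric.ball (0 : EuclideanSpace ℝ (Fin n)) 1 →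
        u x = 0) := by
  -- Positive dimension allows one direction to be split off, leaving `m` transversal ones.
  obtain ⟨m, rfl⟩ := Nat.exists_eq_succ_of_ne_zero (Nat.one_le_iff_ne_zero.1 hn)
  have hs0 : 0 < s := by linarith
  set κ : ℝ := (2 : ℝ) ^ (-(2 * s)) * Real.Gamma (((m + 1 : ℕ) : ℝ) / 2) /
    (Real.Gamma ((((m + 1 : ℕ) : ℝ) + 2 * s) / 2) * Real.Gamma (1 + s)) with hκ_def
  -- The constant of the statement is the reciprocal of the constant value of `(-Δ)^s` on the
  -- profile.
  have hκ : κ * torsionConst m s = 1 := by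
    have h1 : Real.Gamma (((m + 1 : ℕ) : ℝ) / 2) ≠ 0 := (Real.Gamma_pos_of_pos (by positivity)).ne'
    have h2 : Real.Gamma ((((m + 1 : ℕ) : ℝ) + 2 * s) / 2) ≠ 0 :=
      (Real.Gamma_pos_of_pos (by positivity)).ne'
    have h3 : Real.Gamma (1 + s) ≠ 0 := (Real.Gamma_pos_of_pos (by positivity)).ne'
    have h4 : (2 : ℝ) ^ (2 * s) ≠ 0 := by positivity
    rw [torsionConst_eq hs0, hκ_def, Real.rpow_neg (by norm_num)]
    field_simp
  constructor
  · intro hu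
    refine ⟨?_, hu.eq_zero⟩
    filter_upwards [ae_eq_bubble_of_isWeakDirichletSolution hs0 hκ hu] with x hx hxb
    rw [hx, bubble_of_norm_le_one s (mem_ball_zero_iff.1 hxb).le]
  · rintro ⟨h1, h2⟩
    refine isWeakDirichletSolution_of_ae_eq_bubble hs0 hκ ?_
    filter_upwards [h1, h2] with x hx1 hx2
    by_cases h : x ∈ ball 0 1
    · rw [hx1 h, bubble_of_norm_le_one s (mem_ball_zero_iff.1 h).le]
    · rw [hx2 h, bubble_of_one_le hs0 (by simpa using h), mul_zero]
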